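/- Let $d \ge 1$ and let $(\Omega_i,\mathcal F^i,\mathbb P_i)$, $i=1,\dots,d$, be probability spaces, each with a filtration $(\mathcal F^i_n)_{n\ge 0}$. On the product probability space $(\Omega,\mathcal F,\mathbb P)$ put $\mathcal F_n=\sigma(\mathcal F_n^1\times\dots\times\mathcal F_n^d)$. For $\vec p=(p_1,\dots,p_d)$ and a measurable $f:\Omega\to\mathbb R$ let $$\|f\|_{\vec p}=\Big\|\dots\|f\|_{L_{p_1}(dx_1)}\dots\Big\|_{L_{p_d}(dx_d)}$$ be the mixed norm, and for a martingale $f=(f_n)_{n\ge 0}$ with respect to $(\mathcal F_n)$ let $\|f\|_{\vec p}=\sup_n\|f_n\|_{\vec p}$; write $f\in L_{\vec p}$ if this is finite. Suppose $1<p_i<\infty$ for all $i$. Then there is a constant $c$, depending only on $\vec p$, such that the following holds. Let $b_k$ $(k\ge 0)$ be real $\mathcal F_k$-measurable functions with $|b_k|\le 1$ almost everywhere, and let $$(\mathcal T f)_n=\sum_{k=1}^{n} b_{k-1}\,(f_k-f_{k-1}),\qquad n\ge 0 .$$ Then for every martingale $f\in L_{\vec p}$ the sequence $\mathcal T f=((\mathcal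 Tf)_n)$ is again a martingale in $L_{\vec p}$ and $$\|\mathcal T f\|_{\vec p}\le c\,\|f\|_{\vec p}.$$ Moreover the series $\sum_{k=1}^{\infty} b_{k-1}(f_k-f_{k-1})$ converges almost everywhere, and its sum $g$ satisfies $\|g\|_{\vec p}\le c\,\|f\|_{\vec p}$. -/

import Mathlib

open MeasureTheory Filter Topology
open scoped ENNReal NNReal

namespace MixedMartingale

/-- The mixed norm of a function `f` with values in `[0, ∞]` on a product of `d` measure spaces:
first the `L_{p 0}` (quasi-)norm in the first (innermost) variable is taken, then the
`L_{p 1}` norm of the result in the second variable, and so on up to the last variable. -/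
noncomputable def mixedENorm : (d : ℕ) → (p : Fin d → ℝ≥0∞) → (Ω : Fin d → Type*) →
    [∀ i, MeasurableSpace (Ω i)] → (P : ∀ i, Measure (Ω i)) →
    (f : (∀ i, Ω i) → ℝ≥0∞) → ℝ≥0∞
  | 0, _, _, _, _, f => f finZeroElim
  | d + 1, p, Ω, _, P, f =>
      mixedENorm d (fun i => p i.succ) (fun i => Ω i.succ) (fun i => P i.succ)
        (fun y : ∀ i : Fin d, Ω i.succ =>
          eLpNorm (fun x : Ω 0 => f (Fin.cons x y)) (p 0) (P 0))

variable {d : ℕ} {Ω : Fin d → Type*} [mΩ : ∀ i, MeasurableSpace (Ω i)]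

/-- The mixed norm `‖f‖_{(p_1, …, p_d)}` of a real function on a product space. -/
noncomputable def mixedNorm (p : Fin d → ℝ≥0∞) (P : ∀ i, Measure (Ω i))
    (f : (∀ i, Ω i) → ℝ) : ℝ≥0∞ :=
  mixedENorm d p Ω P (fun x => ‖f x‖ₑ)

/-- The filtration `F_n = σ(F_n^1 × ⋯ × F_n^d)` on the product space. -/
def prodFiltration (F : ∀ i, Filtration ℕ (mΩ i)) :
    Filtration ℕ (MeasurableSpace.pi : MeasurableSpace (∀ i, Ω i)) where
  seq n := @MeasurableSpace.pi (Fin d) Ω (fun i => F i n)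
  mono' := fun _ _ h => iSup_mono fun i => MeasurableSpace.comap_mono ((F i).mono h)
  le' := fun n => iSup_mono fun i => MeasurableSpace.comap_mono ((F i).le n)

/-- The norm `sup_n ‖f_n‖_p` of a sequence of functions. -/
noncomputable def seqNorm (p : Fin d → ℝ≥0∞) (P : ∀ i, Measure (Ω i))
    (f : ℕ → (∀ i, Ω i) → ℝ) : ℝ≥0∞ :=
  ⨆ n, mixedNorm p P (f n)

/-- `f` is an `L_p`-bounded martingale for the product filtration. -/
def IsLpBoundedMartingale (p : Fin d → ℝ≥0∞) (P : ∀ i, Measure (Ω i))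
    (F : ∀ i, Filtration ℕ (mΩ i))
    (f : ℕ → (∀ i, Ω i) → ℝ) : Prop :=
  Martingale f (prodFiltration F) (Measure.pi P) ∧ seqNorm p P f < ∞

/-- The martingale transform `(T f)_n = ∑_{k=1}^n b_{k-1} (f_k - f_{k-1})`
(the summation index is shifted by one). -/
def transform {X : Type*} (b f : ℕ → X → ℝ) (n : ℕ) (x : X) : ℝ :=
  ∑ k ∈ Finset.range n, b k x * (f (k + 1) x - f k x)

end MixedMartingale

/-! Duality reduces the bound to estimating `∫ (𝒯f)_N Φ` for bounded `Φ`. With `h_n = E[Φ | F_n]`,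
orthogonality of increments turns this pairing into `∑ ∫ b_n (f_{n+1} - f_n)(h_{n+1} - h_n)`, so
only the sum of `|df_n| |dh_n|` matters. A pathwise estimate (`sum_abs_mul_increment_le`) bounds
that sum by `25 f* h*` plus terms of mean zero, where `f*` and `h*` are running maxima. Mixed
Hölder, together with Doob's maximal inequality in mixed norm for `f` (exponents `p`) and for `h`
(conjugate exponents `p'`), completes the bound. Square functions are not needed.

The main work is Doob's inequality in mixed norm (`mixed_maxBound`), by induction on the number of
variables. Let `R` be the norm already taken in the inner variables. If the inequality holds in
`L_q(R)` for the exponent `q` of the next variable, then by Tonelli it holds in `L_q(L_q(R))`, with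
the outer `L_q` over the remaining variables. The outer exponent must then be freed. To raise it,
the inequality is localized to events of the filtration of the remaining variables, which gives a
conditional estimate, and Garsia's lemma and scalar Doob turn that into a larger exponent
(`IsTimeFamily.lpn_le_extrapConst`). To lower it, one passes to the dual Doob inequality, raises the
conjugate exponent, and dualizes back (`MaxBound.extrapolate_all`).

Almost everywhere convergence is the `L_1` martingale convergence theorem. The bound for the limit
is Fatou's lemma applied to the pairings. -/

namespace MixedMartingale

/-! ### `L_q` norms of nonnegative functions and measurable norming. -/

section Lp

variable {Y : Type*} [MeasurableSpace Y]

/-- The `L_q` norm of a function with values in `[0, ∞]`. -/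
noncomputable def lpn (q : ℝ) (ν : Measure Y) (g : Y → ℝ≥0∞) : ℝ≥0∞ :=
  (∫⁻ y, g y ^ q ∂ν) ^ (1 / q)

variable {ν : Measure Y} {q r : ℝ}

lemma lpn_mono (hq : 0 ≤ q) {f g : Y → ℝ≥0∞} (h : ∀ y, f y ≤ g y) : lpn q ν f ≤ lpn q ν g := by
  unfold lpn
  gcongr with y
  exact h y

lemma lpn_rpow (hq : 0 < q) (g : Y → ℝ≥0∞) : lpn q ν g ^ q = ∫⁻ y, g y ^ q ∂ν := by
  rw [lpn, ← ENNReal.rpow_mul, one_div_mul_cancel hq.ne', ENNReal.rpow_one]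

lemma lpn_le_iff (hq : 0 < q) (g : Y → ℝ≥0∞) (K : ℝ≥0∞) :
    lpn q ν g ≤ K ↔ ∫⁻ y, g y ^ q ∂ν ≤ K ^ q := by
  rw [← lpn_rpow hq, ENNReal.rpow_le_rpow_iff hq]

lemma lpn_const_mul (hq : 0 < q) (c : ℝ≥0∞) {g : Y → ℝ≥0∞} (hg : Measurable g) :
    lpn q ν (fun y => c * g y) = c * lpn q ν g := by
  simp only [lpn, ENNReal.mul_rpow_of_nonneg _ _ hq.le]
  rw [lintegral_const_mul _ (hg.pow_const _), ENNReal.mul_rpow_of_nonneg _ _ (by positivity),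
    ← ENNReal.rpow_mul, mul_one_div_cancel hq.ne', ENNReal.rpow_one]

lemma lpn_rpow_comp (hq : 0 < q) (hr : 0 < r) (g : Y → ℝ≥0∞) :
    lpn r ν (fun y => g y ^ (1 / q)) = lpn (r / q) ν g ^ (1 / q) := by
  simp only [lpn, ← ENNReal.rpow_mul]
  congr 1
  · simp only [one_div_mul_eq_div]
  · field_simp

lemma lpn_add_le (hq : 1 ≤ q) {f g : Y → ℝ≥0∞} (hf : Measurable f) (hg : Measurable g) :
    lpn q ν (fun y => f y + g y) ≤ lpn q ν f + lpn q ν g :=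
  ENNReal.lintegral_Lp_add_le hf.aemeasurable hg.aemeasurable hq

lemma lintegral_mul_le_lpn (hq : q.HolderConjugate r) {f g : Y → ℝ≥0∞} (hf : Measurable f)
    (hg : Measurable g) : ∫⁻ y, f y * g y ∂ν ≤ lpn q ν f * lpn r ν g :=
  ENNReal.lintegral_mul_le_Lp_mul_Lq ν hq hf.aemeasurable hg.aemeasurable

lemma lpn_le_const [IsProbabilityMeasure ν] (hq : 0 < q) {f : Y → ℝ≥0∞} {c : ℝ≥0∞}
    (h : ∀ y, f y ≤ c) : lpn q ν f ≤ c := by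
  rw [lpn_le_iff hq]
  calc ∫⁻ y, f y ^ q ∂ν ≤ ∫⁻ _, c ^ q ∂ν := by gcongr with y; exact h y
    _ = c ^ q := by simp

lemma iSup_min_natCast (x : ℝ≥0∞) : ⨆ n : ℕ, min x n = x := by
  have : ⨆ n : ℕ, min x n = min x (⨆ n : ℕ, (n : ℝ≥0∞)) := by
    rw [inf_iSup_eq]
  rw [this, ENNReal.iSup_natCast]; simp

lemma iSup_rpow' {ι : Type*} (hq : 0 < q) (u : ι → ℝ≥0∞) :
    (⨆ i, u i) ^ q = ⨆ i, u i ^ q :=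
  (ENNReal.orderIsoRpow q hq).map_iSup u

/-- The `L_q` norm is the supremum of the norms of the truncations. -/
lemma lpn_eq_iSup_min (hq : 0 < q) {f : Y → ℝ≥0∞} (hf : Measurable f) :
    lpn q ν f = ⨆ n : ℕ, lpn q ν (fun y => min (f y) n) := by
  unfold lpn
  rw [← iSup_rpow' (by positivity : 0 < 1 / q), ← lintegral_iSup]
  · simp only [← iSup_rpow' hq, iSup_min_natCast]
  · intro n
    exact (hf.min measurable_const).pow_const _
  · intro m n hmn y
    dsimp only
    gcongr

/-- `L_q` norms are attained, up to an arbitrarily small error and measurably in a parameter, by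
pairing with the unit ball of the dual space. -/
lemma lpn_norming {X : Type*} [MeasurableSpace X] (P : Measure X) [IsProbabilityMeasure P]
    (hq : q.HolderConjugate r) {F : X → Y → ℝ≥0∞} (hF : Measurable (Function.uncurry F))
    {φ : Y → ℝ≥0∞} (hφ : Measurable φ) {c : ℝ≥0∞}
    (hc : c < ∫⁻ y, lpn q P (fun x => F x y) * φ y ∂ν) :
    ∃ k : X → Y → ℝ≥0∞, Measurable (Function.uncurry k) ∧
      (∀ y, lpn r P (fun x => k x y) ≤ 1) ∧
      c < ∫⁻ y, (∫⁻ x, F x y * k x y ∂P) * φ y ∂ν := by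
  have hq0 : 0 < q := hq.pos
  have hr0 : 0 < r := hq.symm.pos
  have hq1 : 0 < q - 1 := by linarith [hq.lt]
  have hm : ∀ n : ℕ, Measurable fun z : X × Y => min (F z.1 z.2) n := fun n =>
    hF.min measurable_const
  have hNm : ∀ n : ℕ, Measurable fun y => lpn q P (fun x => min (F x y) n) := fun n =>
    (Measurable.lintegral_prod_left' (f := fun z : X × Y => min (F z.1 z.2) n ^ q)
      ((hm n).pow_const q)).pow_const _
  -- Truncating `F` makes its norm finite, so that it can be divided out below.
  have h1 : ∫⁻ y, lpn q P (fun x => F x y) * φ y ∂ν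
      = ⨆ n : ℕ, ∫⁻ y, lpn q P (fun x => min (F x y) n) * φ y ∂ν := by
    rw [← lintegral_iSup]
    · congr 1 with y
      rw [lpn_eq_iSup_min (f := fun x => F x y) hq0 (hF.comp measurable_prodMk_right),
        ENNReal.iSup_mul]
    · intro n
      exact (hNm n).mul hφ
    · intro m n hmn y
      dsimp only
      gcongr
      exact lpn_mono hq0.le fun x => by gcongr
  rw [h1, lt_iSup_iff] at hc
  obtain ⟨n, hn⟩ := hc
  set N : Y → ℝ≥0∞ := fun y => lpn q P (fun x => min (F x y) n) with hN
  have hNfin : ∀ y, N y ≠ ∞ := fun y =>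
    ((lpn_le_const hq0 fun x => min_le_right _ _).trans_lt (ENNReal.natCast_lt_top n)).ne
  have hint : ∀ y, ∫⁻ x, min (F x y) n ^ q ∂P = N y ^ q := fun y => (lpn_rpow hq0 _).symm
  have hmy : ∀ y, Measurable fun x => min (F x y) n := fun y => (hm n).comp measurable_prodMk_right
  -- The extremal function of Hölder's inequality; being explicit, it is jointly measurable.
  refine ⟨fun x y => min (F x y) n ^ (q - 1) * (N y ^ (q - 1))⁻¹, ?_, ?_, hn.trans_le ?_⟩
  · exact ((hm n).pow_const _).mul (((hNm n).comp measurable_snd).pow_const _).inv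
  · intro y
    rw [lpn_le_iff hr0, ENNReal.one_rpow]
    have e1 : (q - 1) * r = q := hq.sub_one_mul_conj
    have : ∀ x, (min (F x y) n ^ (q - 1) * (N y ^ (q - 1))⁻¹) ^ r
        = min (F x y) n ^ q * (N y ^ q)⁻¹ := fun x => by
      rw [ENNReal.mul_rpow_of_nonneg _ _ hr0.le, ENNReal.inv_rpow, ← ENNReal.rpow_mul,
        ← ENNReal.rpow_mul, e1]
    simp only [this]
    rw [lintegral_mul_const _ ((hmy y).pow_const _), hint]
    exact ENNReal.mul_inv_le_one _
  · refine lintegral_mono fun y => ?_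
    dsimp only
    gcongr
    by_cases h0 : N y = 0
    · rw [hN] at h0; dsimp only at h0; rw [h0]; exact zero_le
    have : N y = ∫⁻ x, min (F x y) n ^ q * (N y ^ (q - 1))⁻¹ ∂P := by
      rw [lintegral_mul_const _ ((hmy y).pow_const _), hint, ← ENNReal.rpow_neg,
        ← ENNReal.rpow_add _ _ h0 (hNfin y)]
      simp
    refine this.le.trans (lintegral_mono fun x => ?_)
    dsimp only
    rw [← mul_assoc]
    gcongr
    calc min (F x y) n ^ q = min (F x y) n * min (F x y) n ^ (q - 1) := by
          conv_rhs => enter [1]; rw [← ENNReal.rpow_one (min (F x y) n)]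
          rw [← ENNReal.rpow_add_of_nonneg _ _ zero_le_one hq1.le]
          congr 1; ring
      _ ≤ F x y * min (F x y) n ^ (q - 1) := by gcongr; exact min_le_left _ _

end Lp

/-! ### One-sided conditional expectation bounds. -/

section CondLE

variable {W : Type*} {m mW : MeasurableSpace W} {μ : Measure W}

/-- `e` is `m`-measurable and bounded above by the conditional expectation of `f` given `m`. -/
def CondLE (m : MeasurableSpace W) {mW : MeasurableSpace W} (μ : Measure W) (e f : W → ℝ≥0∞) :
    Prop :=
  Measurable[m] e ∧ ∀ s, MeasurableSet[m] s → ∫⁻ x in s, e x ∂μ ≤ ∫⁻ x in s, f x ∂μ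

/-- The hypothesis is an inequality between the measures `e μ` and `f μ` restricted to `m`, so it
can be integrated against any `m`-measurable `φ ≥ 0`. -/
lemma lintegral_mul_le_of_setLIntegral_le (hm : m ≤ mW) {e f φ : W → ℝ≥0∞} (he : Measurable e)
    (hf : Measurable f)
    (h : ∀ s, MeasurableSet[m] s → ∫⁻ x in s, e x ∂μ ≤ ∫⁻ x in s, f x ∂μ)
    (hφ : Measurable[m] φ) : ∫⁻ x, e x * φ x ∂μ ≤ ∫⁻ x, f x * φ x ∂μ := by
  have key : (μ.withDensity e).trim hm ≤ (μ.withDensity f).trim hm := by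
    refine Measure.le_iff.2 fun s hs => ?_
    rw [trim_measurableSet_eq hm hs, trim_measurableSet_eq hm hs, withDensity_apply _ (hm s hs),
      withDensity_apply _ (hm s hs)]
    exact h s hs
  have h2 := lintegral_mono' key (le_refl φ)
  rw [lintegral_trim hm hφ, lintegral_trim hm hφ,
    lintegral_withDensity_eq_lintegral_mul _ he (hφ.mono hm le_rfl),
    lintegral_withDensity_eq_lintegral_mul _ hf (hφ.mono hm le_rfl)] at h2
  exact h2

lemma CondLE.lintegral_mul_le (hm : m ≤ mW) {e f φ : W → ℝ≥0∞} (h : CondLE m μ e f)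
    (hf : Measurable f) (hφ : Measurable[m] φ) :
    ∫⁻ x, e x * φ x ∂μ ≤ ∫⁻ x, f x * φ x ∂μ :=
  lintegral_mul_le_of_setLIntegral_le hm (h.1.mono hm le_rfl) hf h.2 hφ

lemma CondLE.mul (hm : m ≤ mW) {e f φ : W → ℝ≥0∞} (h : CondLE m μ e f)
    (hf : Measurable f) (hφ : Measurable[m] φ) :
    CondLE m μ (fun x => φ x * e x) (fun x => φ x * f x) := by
  refine ⟨hφ.mul h.1, fun s hs => ?_⟩
  have := h.lintegral_mul_le hm hf (hφ.indicator hs)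
  rw [← lintegral_indicator (hm s hs), ← lintegral_indicator (hm s hs)]
  convert! this using 2 <;> ext x <;> by_cases hx : x ∈ s <;> simp [hx, mul_comm]

lemma condLE_condLExp [IsFiniteMeasure μ] (hm : m ≤ mW) (f : W → ℝ≥0∞) :
    CondLE m μ (condLExp m μ f) f :=
  ⟨measurable_condLExp _ _ _, fun _ hs => (setLIntegral_condLExp hm μ f hs).le⟩

lemma lintegral_mul_condLExp [IsFiniteMeasure μ] (hm : m ≤ mW) {e f : W → ℝ≥0∞}
    (he : Measurable[m] e) (hf : Measurable f) :
    ∫⁻ x, e x * f x ∂μ ≤ ∫⁻ x, e x * condLExp m μ f x ∂μ := by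
  have := lintegral_mul_le_of_setLIntegral_le (μ := μ) (φ := e) hm hf
    (measurable_condLExp' m μ f) (fun s hs => (setLIntegral_condLExp hm μ f hs).ge) he
  simpa only [mul_comm] using this

end CondLE

/-! ### Garsia's lemma for increasing processes. -/

section Garsia

/-- Convexity of `t ^ r`, obtained from Young's inequality for `a * b ^ (r - 1)`. -/
lemma rpow_sub_rpow_le {r a b : ℝ} (hr : 1 < r) (ha : 0 ≤ a) (hb : 0 ≤ b) :
    b ^ r - a ^ r ≤ r * ((b - a) * b ^ (r - 1)) := by
  have hq := Real.HolderConjugate.conjExponent hr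
  have hy := Real.young_inequality_of_nonneg ha (Real.rpow_nonneg hb (r - 1)) hq
  rw [← Real.rpow_mul hb, hq.sub_one_mul_conj] at hy
  have hbr : b * b ^ (r - 1) = b ^ r := by
    nth_rewrite 1 [← Real.rpow_one b]
    rw [← Real.rpow_add_of_nonneg hb zero_le_one (by linarith)]
    congr 1; ring
  have hinv : b ^ r / r.conjExponent = b ^ r - b ^ r / r := by
    have := hq.inv_add_inv_eq_one
    field_simp at this ⊢
    linear_combination this * b ^ r
  have h2 := mul_le_mul_of_nonneg_left hy hq.nonneg
  rw [hinv] at h2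
  have h3 : r * (a ^ r / r + (b ^ r - b ^ r / r)) = a ^ r + (r * b ^ r - b ^ r) := by
    field_simp
  rw [h3] at h2
  linear_combination h2 - r * hbr

lemma rpow_le_sum_increments {r : ℝ} (hr : 1 < r) {z : ℕ → ℝ} (h0 : 0 ≤ z 0) (hz : Monotone z)
    (N : ℕ) :
    z N ^ r ≤ r * (z N * z 0 ^ (r - 1) +
      ∑ n ∈ Finset.range N, (z N - z n) * (z (n + 1) ^ (r - 1) - z n ^ (r - 1))) := by
  have hnn : ∀ n, 0 ≤ z n := fun n => h0.trans (hz n.zero_le)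
  -- Summation by parts: the extra boundary term makes the induction close and vanishes at `M = N`.
  suffices ∀ M, z M ^ r + r * ((z N - z M) * z M ^ (r - 1)) ≤ r * (z N * z 0 ^ (r - 1) +
      ∑ n ∈ Finset.range M, (z N - z n) * (z (n + 1) ^ (r - 1) - z n ^ (r - 1))) by
    simpa using this N
  intro M
  induction M with
  | zero =>
    have := rpow_sub_rpow_le hr (le_refl 0) h0
    rw [Real.zero_rpow (by linarith)] at this
    simp only [Finset.range_zero, Finset.sum_empty]
    linarith
  | succ M ih =>
    rw [Finset.sum_range_succ]
    have := rpow_sub_rpow_le hr (hnn M) (hnn (M + 1))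
    linarith

variable {Y : Type*} {mY : MeasurableSpace Y} {ν : Measure Y} {𝓗 : Filtration ℕ mY}

lemma ennreal_rpow_le_sum_increments {r : ℝ} (hr : 1 < r) {z v : ℕ → ℝ≥0∞} {N : ℕ}
    (hz : Monotone z) (hfin : ∀ n, z n ≠ ∞) (h0 : z N ≤ v 0)
    (hv : ∀ n < N, z N ≤ z n + v (n + 1)) :
    z N ^ r ≤ ENNReal.ofReal r * (v 0 * z 0 ^ (r - 1) +
      ∑ n ∈ Finset.range N, v (n + 1) * (z (n + 1) ^ (r - 1) - z n ^ (r - 1))) := by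
  have hr1 : 0 ≤ r - 1 := by linarith
  have hmono : Monotone fun n => (z n).toReal := fun m n hmn =>
    ENNReal.toReal_mono (hfin n) (hz hmn)
  have hpow : ∀ n, ∀ t : ℝ, 0 ≤ t → z n ^ t = ENNReal.ofReal ((z n).toReal ^ t) := fun n t ht => by
    rw [← ENNReal.ofReal_rpow_of_nonneg ENNReal.toReal_nonneg ht, ENNReal.ofReal_toReal (hfin n)]
  have key := rpow_le_sum_increments hr (z := fun n => (z n).toReal) ENNReal.toReal_nonneg hmono N
  have hd : ∀ n, 0 ≤ (z (n + 1)).toReal ^ (r - 1) - (z n).toReal ^ (r - 1) := fun n =>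
    sub_nonneg.2 (Real.rpow_le_rpow ENNReal.toReal_nonneg (hmono n.le_succ) hr1)
  have hd' : ∀ n < N, 0 ≤ (z N).toReal - (z n).toReal := fun n hn => sub_nonneg.2 (hmono hn.le)
  rw [hpow N r (by linarith)]
  refine (ENNReal.ofReal_le_ofReal key).trans ?_
  rw [ENNReal.ofReal_mul (by linarith)]
  gcongr
  rw [ENNReal.ofReal_add (mul_nonneg ENNReal.toReal_nonneg
      (Real.rpow_nonneg ENNReal.toReal_nonneg _))
    (Finset.sum_nonneg fun n hn => mul_nonneg (hd' n (Finset.mem_range.1 hn)) (hd n)),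
    ENNReal.ofReal_sum_of_nonneg
      (fun n hn => mul_nonneg (hd' n (Finset.mem_range.1 hn)) (hd n))]
  gcongr with n hn
  · rw [ENNReal.ofReal_mul ENNReal.toReal_nonneg, ENNReal.ofReal_toReal (hfin N), ← hpow 0 _ hr1]
    gcongr
  · have hn := Finset.mem_range.1 hn
    rw [ENNReal.ofReal_mul (hd' n hn), ENNReal.ofReal_sub _ ENNReal.toReal_nonneg,
      ENNReal.ofReal_sub _ (Real.rpow_nonneg ENNReal.toReal_nonneg _), ← hpow _ _ hr1,
      ← hpow _ _ hr1, ENNReal.ofReal_toReal (hfin N), ENNReal.ofReal_toReal (hfin n)]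
    gcongr
    exact tsub_le_iff_left.2 (hv n hn)

lemma sum_increments_eq {w : ℕ → ℝ≥0∞} (hw : Monotone w) (N : ℕ) :
    w 0 + ∑ n ∈ Finset.range N, (w (n + 1) - w n) = w N := by
  induction N with
  | zero => simp
  | succ N ih =>
    rw [Finset.sum_range_succ, ← add_assoc, ih, add_tsub_cancel_of_le (hw N.le_succ)]

/-- Garsia's lemma for bounded processes. -/
lemma lpn_le_of_increment_le_of_bdd [IsProbabilityMeasure ν] {r : ℝ} (hr : 1 < r) {N : ℕ}
    {Z V : ℕ → Y → ℝ≥0∞} {G : Y → ℝ≥0∞} {c : ℝ≥0∞} (hc : c ≠ ∞) (hZc : ∀ n y, Z n y ≤ c)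
    (hZm : ∀ n, Measurable[𝓗 n] (Z n)) (hV : ∀ n, Measurable (V n)) (hG : Measurable G)
    (hmono : ∀ y, Monotone fun n => Z n y) (h0 : ∀ y, Z N y ≤ V 0 y)
    (hincr : ∀ n < N, ∀ y, Z N y ≤ Z n y + V (n + 1) y)
    (hVG : ∀ n ≤ N, ∀ s, MeasurableSet[𝓗 n] s → ∫⁻ y in s, V n y ∂ν ≤ ∫⁻ y in s, G y ∂ν) :
    lpn r ν (Z N) ≤ ENNReal.ofReal r * lpn r ν G := by
  have hr0 : 0 < r := by linarith
  have hr1 : 0 ≤ r - 1 := by linarith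
  have hq := Real.HolderConjugate.conjExponent hr
  set q := r.conjExponent
  have hZm' : ∀ n, Measurable (Z n) := fun n => (hZm n).mono (𝓗.le n) le_rfl
  set w : ℕ → Y → ℝ≥0∞ := fun n y => Z n y ^ (r - 1) with hw
  have hwm : ∀ n, Measurable[𝓗 n] (w n) := fun n => (hZm n).pow_const _
  have hwm' : ∀ n, Measurable (w n) := fun n => (hwm n).mono (𝓗.le n) le_rfl
  have hwmono : ∀ y, Monotone fun n => w n y := fun y m n hmn => by
    dsimp only [hw]
    exact ENNReal.rpow_le_rpow (hmono y hmn) hr1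
  have hdm : ∀ n, Measurable[𝓗 (n + 1)] fun y => w (n + 1) y - w n y := fun n =>
    (hwm (n + 1)).sub ((hwm n).mono (𝓗.mono n.le_succ) le_rfl)
  have hdm' : ∀ n, Measurable fun y => w (n + 1) y - w n y := fun n =>
    (hdm n).mono (𝓗.le _) le_rfl
  have hmul0 : ∀ {f : Y → ℝ≥0∞}, Measurable f → Measurable fun y => f y * w 0 y := fun hf =>
    hf.mul (hwm' 0)
  have hmul : ∀ {f : Y → ℝ≥0∞}, Measurable f → ∀ n,
      Measurable fun y => f y * (w (n + 1) y - w n y) := fun hf n => hf.mul (hdm' n)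
  have hpair : ∫⁻ y, Z N y ^ r ∂ν ≤ ENNReal.ofReal r * ∫⁻ y, G y * w N y ∂ν := by
    calc ∫⁻ y, Z N y ^ r ∂ν
        ≤ ∫⁻ y, ENNReal.ofReal r * (V 0 y * w 0 y +
            ∑ n ∈ Finset.range N, V (n + 1) y * (w (n + 1) y - w n y)) ∂ν :=
          lintegral_mono fun y => ennreal_rpow_le_sum_increments (v := fun n => V n y) hr (hmono y)
            (fun n => ((hZc n y).trans_lt hc.lt_top).ne) (h0 y) fun n hn => hincr n hn y
      _ = ENNReal.ofReal r * (∫⁻ y, V 0 y * w 0 y ∂ν +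
            ∑ n ∈ Finset.range N, ∫⁻ y, V (n + 1) y * (w (n + 1) y - w n y) ∂ν) := by
          rw [lintegral_const_mul, lintegral_add_left (hmul0 (hV 0)),
            lintegral_finsetSum _ fun n _ => hmul (hV _) n]
          exact (hmul0 (hV 0)).add
            (Finset.measurable_fun_sum _ fun n _ => hmul (hV _) n)
      _ ≤ ENNReal.ofReal r * (∫⁻ y, G y * w 0 y ∂ν +
            ∑ n ∈ Finset.range N, ∫⁻ y, G y * (w (n + 1) y - w n y) ∂ν) := by
          -- The weight multiplying `V (n + 1)` is `𝓗 (n + 1)`-measurable, which is why `V` may be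
          -- replaced by `G`; the weights then telescope to `w N`.
          refine mul_le_mul_right (add_le_add ?_ (Finset.sum_le_sum fun n hn => ?_)) _
          · exact lintegral_mul_le_of_setLIntegral_le (𝓗.le 0) (hV 0) hG (hVG 0 N.zero_le) (hwm 0)
          · exact lintegral_mul_le_of_setLIntegral_le (𝓗.le (n + 1)) (hV _) hG
              (hVG (n + 1) (Finset.mem_range.1 hn)) (hdm n)
      _ = ENNReal.ofReal r * ∫⁻ y, G y * w N y ∂ν := by
          rw [← lintegral_finsetSum _ fun n _ => hmul hG n,
            ← lintegral_add_left (hmul0 hG)]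
          simp only [← Finset.mul_sum, ← mul_add]
          congr 2 with y
          rw [sum_increments_eq (hwmono y)]
  have hI : lpn q ν (w N) = (∫⁻ y, Z N y ^ r ∂ν) ^ (1 / q) := by
    simp only [lpn, hw, ← ENNReal.rpow_mul, hq.sub_one_mul_conj]
  -- Boundedness of `Z` enters here: a factor `I ^ (1 / q)` is cancelled at the end.
  have hIfin : ∫⁻ y, Z N y ^ r ∂ν ≠ ∞ := by
    rw [← lpn_rpow hr0]
    exact ENNReal.rpow_ne_top_of_nonneg hr0.le
      ((lpn_le_const hr0 (hZc N)).trans_lt hc.lt_top).ne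
  set I := ∫⁻ y, Z N y ^ r ∂ν with hIdef
  have hle : I ≤ ENNReal.ofReal r * lpn r ν G * I ^ (1 / q) := by
    rw [mul_assoc, ← hI]
    exact hpair.trans (by gcongr; exact lintegral_mul_le_lpn hq hG (hwm' N))
  change I ^ (1 / r) ≤ _
  by_cases hI0 : I = 0
  · rw [hI0, ENNReal.zero_rpow_of_pos (by positivity)]; exact zero_le
  have hsplit : I = I ^ (1 / r) * I ^ (1 / q) := by
    rw [← ENNReal.rpow_add _ _ hI0 hIfin, one_div, one_div, hq.inv_add_inv_eq_one,
      ENNReal.rpow_one]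
  have hq0 : 0 < q := hq.symm.pos
  have h1 : I ^ (1 / q) ≠ 0 := by
    simp [ENNReal.rpow_eq_zero_iff, hI0, hIfin]
  have h2 : I ^ (1 / q) ≠ ∞ := ENNReal.rpow_ne_top_of_nonneg (by positivity) hIfin
  exact (ENNReal.mul_le_mul_iff_left h1 h2).1 (hsplit.symm.le.trans hle)

/-- **Garsia's lemma**: if the conditional expectation of the increment of an increasing process
after each time is controlled by that of `G`, then so is its `L_r` norm. -/
lemma lpn_le_of_increment_le [IsProbabilityMeasure ν] {r : ℝ} (hr : 1 < r) {N : ℕ}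
    {Z V : ℕ → Y → ℝ≥0∞} {G : Y → ℝ≥0∞}
    (hZm : ∀ n, Measurable[𝓗 n] (Z n)) (hV : ∀ n, Measurable (V n)) (hG : Measurable G)
    (hmono : ∀ y, Monotone fun n => Z n y) (h0 : ∀ y, Z N y ≤ V 0 y)
    (hincr : ∀ n < N, ∀ y, Z N y ≤ Z n y + V (n + 1) y)
    (hVG : ∀ n ≤ N, ∀ s, MeasurableSet[𝓗 n] s → ∫⁻ y in s, V n y ∂ν ≤ ∫⁻ y in s, G y ∂ν) :
    lpn r ν (Z N) ≤ ENNReal.ofReal r * lpn r ν G := by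
  -- Capping `Z` at a constant preserves all hypotheses with the same `V` and `G`.
  rw [lpn_eq_iSup_min (by linarith) ((hZm N).mono (𝓗.le N) le_rfl)]
  refine iSup_le fun c => ?_
  refine lpn_le_of_increment_le_of_bdd (𝓗 := 𝓗) (Z := fun n y => min (Z n y) c) (V := V) hr
    (ENNReal.natCast_ne_top c) (fun n y => min_le_right _ _)
    (fun n => (hZm n).min measurable_const) hV hG ?_ (fun y => (min_le_left _ _).trans (h0 y)) ?_
    hVG
  · intro y m n hmn
    exact min_le_min_right _ (hmono y hmn)
  · intro n hn y
    rcases le_total (Z n y) c with h | h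
    · rw [min_eq_left h]
      exact (min_le_left _ _).trans (hincr n hn y)
    · rw [min_eq_right h]
      exact (min_le_right _ _).trans le_self_add

end Garsia

/-! ### Processes indexed by sets of times, and conditional Jensen. -/

section Extrapolation

variable {Y : Type*} {mY : MeasurableSpace Y} {ν : Measure Y} {𝓗 : Filtration ℕ mY}

/-- A monotone and suitably subadditive function of finite sets of times, seen as a process. -/
structure IsTimeFamily (𝓗 : Filtration ℕ mY) (T : Finset ℕ) (Φ : Finset ℕ → Y → ℝ≥0∞) : Prop where
  adapted : ∀ n, Measurable[𝓗 n] (Φ (T.filter (· ≤ n)))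
  measurable : ∀ n, Measurable (Φ (T.filter (n ≤ ·)))
  mono : ∀ S S', S ⊆ S' → S' ⊆ T → ∀ y, Φ S y ≤ Φ S' y
  split : ∀ n y, Φ T y ≤ Φ (T.filter (· ≤ n)) y + Φ (T.filter (n + 1 ≤ ·)) y

/-- Garsia's lemma with the past `Φ (T ∩ [0, n])` as increasing process and the future `Φ (T ∩ [n,
∞))` as bound for its later increments. -/
lemma IsTimeFamily.lpn_le [IsProbabilityMeasure ν] {T : Finset ℕ} {Φ : Finset ℕ → Y → ℝ≥0∞}
    (h : IsTimeFamily 𝓗 T Φ) {r : ℝ} (hr : 1 < r) {G : Y → ℝ≥0∞} (hG : Measurable G)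
    (hΦ : ∀ n ≤ T.sup id, ∀ s, MeasurableSet[𝓗 n] s →
      ∫⁻ y in s, Φ (T.filter (n ≤ ·)) y ∂ν ≤ ∫⁻ y in s, G y ∂ν) :
    lpn r ν (Φ T) ≤ ENNReal.ofReal r * lpn r ν G := by
  have hT : T.filter (· ≤ T.sup id) = T :=
    Finset.filter_true_of_mem fun n hn => Finset.le_sup (f := id) hn
  have hT0 : T.filter (0 ≤ ·) = T := Finset.filter_true_of_mem fun n _ => n.zero_le
  have := lpn_le_of_increment_le (𝓗 := 𝓗) (ν := ν) (N := T.sup id) hr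
    (Z := fun n => Φ (T.filter (· ≤ n))) (V := fun n => Φ (T.filter (n ≤ ·))) h.adapted
    h.measurable hG
    (fun y m n hmn => h.mono _ _
      (Finset.monotone_filter_right _ fun k _ hk => hk.trans hmn) (Finset.filter_subset _ _) y)
    (fun y => by rw [hT, hT0]) (fun n _ y => by rw [hT]; exact h.split n y)
    hΦ
  rwa [hT] at this

/-- Young's inequality for `v = (v φ ^ (-1/t)) * φ ^ (1/t)`; the values `φ = 0, ∞` are separate. -/
lemma young_split {s t : ℝ} (hs : s.HolderConjugate t) (v φ : ℝ≥0∞) :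
    v ≤ v ^ s * φ ^ (1 - s) / ENNReal.ofReal s + φ / ENNReal.ofReal t := by
  by_cases hφ : φ = ∞
  · simp [hφ, ENNReal.top_div]
  have hs1 : 1 - s < 0 := by linarith [hs.lt]
  by_cases h0 : φ = 0
  · by_cases hv : v = 0
    · simp [hv]
    · have : v ^ s ≠ 0 := by simp [ENNReal.rpow_eq_zero_iff, hv, hs.pos, hs.pos.not_gt]
      rw [h0, ENNReal.zero_rpow_of_neg hs1, ENNReal.mul_top this, ENNReal.top_div_of_ne_top]
      · simp
      · simp
  · have h := ENNReal.young_inequality (v * φ ^ (-(1 / t))) (φ ^ (1 / t)) hs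
    rw [mul_assoc, ← ENNReal.rpow_add _ _ h0 hφ, neg_add_cancel, ENNReal.rpow_zero, mul_one,
      ENNReal.mul_rpow_of_nonneg _ _ hs.nonneg, ← ENNReal.rpow_mul, ← ENNReal.rpow_mul,
      one_div_mul_cancel hs.symm.ne_zero, ENNReal.rpow_one] at h
    convert! h using 5
    have := hs.sub_one_mul_conj
    have := hs.symm.ne_zero
    field_simp
    linarith

/-- A form of the conditional Jensen inequality. -/
lemma setLIntegral_le_of_rpow_le {m : MeasurableSpace Y} (hm : m ≤ mY) {s : ℝ} (hs : 1 < s)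
    {V φ : Y → ℝ≥0∞} (hV : Measurable[mY] V) (hφ : Measurable[m] φ)
    (h : ∀ B, MeasurableSet[m] B → ∫⁻ y in B, V y ^ s ∂ν ≤ ∫⁻ y in B, φ y ^ s ∂ν)
    {B : Set Y} (hB : MeasurableSet[m] B) : ∫⁻ y in B, V y ∂ν ≤ ∫⁻ y in B, φ y ∂ν := by
  have ht := Real.HolderConjugate.conjExponent hs
  set t := s.conjExponent
  have hφ' := hφ.mono hm le_rfl
  have hVφ : Measurable[mY] fun y => V y ^ s * φ y ^ (1 - s) :=
    (hV.pow_const _).mul (hφ'.pow_const _)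
  -- The hypothesis is tested against `φ ^ (1 - s)`, as `φ ^ s * φ ^ (1 - s) ≤ φ` even when `φ` is
  -- `0` or `∞`.
  have h1 : ∫⁻ y in B, V y ^ s * φ y ^ (1 - s) ∂ν ≤ ∫⁻ y in B, φ y ∂ν := by
    calc ∫⁻ y in B, V y ^ s * φ y ^ (1 - s) ∂ν
        = ∫⁻ y, V y ^ s * B.indicator (fun y => φ y ^ (1 - s)) y ∂ν := by
          rw [← lintegral_indicator (hm B hB)]
          congr 1 with y
          by_cases hy : y ∈ B <;> simp [hy]
      _ ≤ ∫⁻ y, φ y ^ s * B.indicator (fun y => φ y ^ (1 - s)) y ∂ν :=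
          lintegral_mul_le_of_setLIntegral_le hm (hV.pow_const _) (hφ'.pow_const _) h
            ((hφ.pow_const _).indicator hB)
      _ ≤ ∫⁻ y in B, φ y ∂ν := by
          rw [← lintegral_indicator (hm B hB)]
          refine lintegral_mono fun y => ?_
          by_cases hy : y ∈ B
          · simp only [hy, Set.indicator_of_mem]
            by_cases h0 : φ y = 0
            · simp [h0, ht.pos]
            by_cases hi : φ y = ∞
            · simp [hi]
            rw [← ENNReal.rpow_add _ _ h0 hi]
            simp
          · simp [hy]
  calc ∫⁻ y in B, V y ∂ν
      ≤ ∫⁻ y in B, (V y ^ s * φ y ^ (1 - s) * (ENNReal.ofReal s)⁻¹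
          + φ y * (ENNReal.ofReal t)⁻¹) ∂ν := lintegral_mono fun y => young_split ht _ _
    _ = (∫⁻ y in B, V y ^ s * φ y ^ (1 - s) ∂ν) * (ENNReal.ofReal s)⁻¹
          + (∫⁻ y in B, φ y ∂ν) * (ENNReal.ofReal t)⁻¹ := by
        rw [lintegral_add_right _ (hφ'.mul_const _), lintegral_mul_const _ hφ',
          lintegral_mul_const _ hVφ]
    _ ≤ (∫⁻ y in B, φ y ∂ν) * (ENNReal.ofReal s)⁻¹
          + (∫⁻ y in B, φ y ∂ν) * (ENNReal.ofReal t)⁻¹ := by gcongr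
    _ = ∫⁻ y in B, φ y ∂ν := by
        rw [← mul_add, ht.inv_add_inv_ennreal, mul_one]

end Extrapolation

/-! ### Norms along fibres; Doob's inequality and its dual. -/

section FiberNorm

variable {W Y : Type*} {mW : MeasurableSpace W} {mY : MeasurableSpace Y}

/-- The laws of a norm `R` along the fibres of `π : W → Y`, compatible with filtrations. -/
structure FiberLaws (π : W → Y) (𝓕 : Filtration ℕ mW) (𝓗 : Filtration ℕ mY)
    (R : (W → ℝ≥0∞) → Y → ℝ≥0∞) : Prop where
  mono : ∀ {f g : W → ℝ≥0∞}, (∀ w, f w ≤ g w) → ∀ y, R f y ≤ R g y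
  add : ∀ {f g : W → ℝ≥0∞}, Measurable f → Measurable g →
    ∀ y, R (fun w => f w + g w) y ≤ R f y + R g y
  mul : ∀ {f : W → ℝ≥0∞} {φ : Y → ℝ≥0∞}, Measurable f → Measurable φ →
    R (fun w => φ (π w) * f w) = fun y => φ y * R f y
  measurable : ∀ {f : W → ℝ≥0∞}, Measurable f → Measurable (R f)
  adapted : ∀ n {f : W → ℝ≥0∞}, Measurable[𝓕 n] f → Measurable[𝓗 n] (R f)

/-- A pair of norms along the fibres of `π : W → Y` that are dual to each other. -/
structure IsFiberNorm (π : W → Y) (μ : Measure W) (ν : Measure Y) (𝓕 : Filtration ℕ mW)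
    (𝓗 : Filtration ℕ mY) (R R' : (W → ℝ≥0∞) → Y → ℝ≥0∞) : Prop where
  measurable_proj : Measurable π
  adapted_proj : ∀ n, Measurable[𝓕 n, 𝓗 n] π
  left : FiberLaws π 𝓕 𝓗 R
  right : FiberLaws π 𝓕 𝓗 R'
  holder : ∀ {f g : W → ℝ≥0∞}, Measurable f → Measurable g →
    ∫⁻ w, f w * g w ∂μ ≤ ∫⁻ y, R f y * R' g y ∂ν
  norming_left : ∀ {F : W → ℝ≥0∞} {φ : Y → ℝ≥0∞} {c : ℝ≥0∞}, Measurable F → Measurable φ →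
    c < ∫⁻ y, R F y * φ y ∂ν → ∃ k : W → ℝ≥0∞, Measurable k ∧ (∀ y, R' k y ≤ 1) ∧
      c < ∫⁻ w, F w * k w * φ (π w) ∂μ
  norming_right : ∀ {F : W → ℝ≥0∞} {φ : Y → ℝ≥0∞} {c : ℝ≥0∞}, Measurable F → Measurable φ →
    c < ∫⁻ y, R' F y * φ y ∂ν → ∃ k : W → ℝ≥0∞, Measurable k ∧ (∀ y, R k y ≤ 1) ∧
      c < ∫⁻ w, F w * k w * φ (π w) ∂μ

variable {π : W → Y} {μ : Measure W} {ν : Measure Y} {𝓕 : Filtration ℕ mW} {𝓗 : Filtration ℕ mY}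
  {R R' : (W → ℝ≥0∞) → Y → ℝ≥0∞}

lemma IsFiberNorm.symm (h : IsFiberNorm π μ ν 𝓕 𝓗 R R') : IsFiberNorm π μ ν 𝓕 𝓗 R' R where
  measurable_proj := h.measurable_proj
  adapted_proj := h.adapted_proj
  left := h.right
  right := h.left
  holder hf hg := by simpa only [mul_comm] using h.holder hg hf
  norming_left := h.norming_right
  norming_right := h.norming_left

lemma isFiberNorm_id (μ : Measure W) (𝓕 : Filtration ℕ mW) :
    IsFiberNorm id μ μ 𝓕 𝓕 (fun f => f) (fun f => f) := by
  have hl : FiberLaws id 𝓕 𝓕 (fun f => f) :=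
    ⟨fun h => h, fun _ _ _ => le_rfl, fun _ _ => rfl, fun h => h, fun _ _ h => h⟩
  have hn : ∀ {F : W → ℝ≥0∞} {φ : W → ℝ≥0∞} {c : ℝ≥0∞}, Measurable F → Measurable φ →
    c < ∫⁻ y, F y * φ y ∂μ → ∃ k : W → ℝ≥0∞, Measurable k ∧ (∀ y, k y ≤ 1) ∧
      c < ∫⁻ w, F w * k w * φ (id w) ∂μ := fun _ _ h =>
    ⟨fun _ => 1, measurable_const, fun _ => le_rfl, by simpa using h⟩
  exact ⟨measurable_id, fun _ => measurable_id, hl, hl, fun _ _ => le_rfl, hn, hn⟩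

/-- The norm of `L_q(R)` is dominated by pairings with `L_{q'}(R')`. -/
lemma IsFiberNorm.lpn_le_of_forall_pairing (h : IsFiberNorm π μ ν 𝓕 𝓗 R R')
    [IsProbabilityMeasure ν] {q r : ℝ} (hq : q.HolderConjugate r) {F : W → ℝ≥0∞}
    (hF : Measurable F) {K : ℝ≥0∞}
    (hK : ∀ k : W → ℝ≥0∞, Measurable k → ∫⁻ w, F w * k w ∂μ ≤ K * lpn r ν (R' k)) :
    lpn q ν (R F) ≤ K := by
  by_contra hlt
  rw [not_le] at hlt
  -- A one-point parameter space gives ordinary norming in `L_q(ν)`; `κ` norms the outer norm, then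
  -- `k` norms `R` along the fibres.
  obtain ⟨κ, hκm, hκ, hlt⟩ := lpn_norming (Y := Unit) (ν := Measure.dirac ()) (P := ν)
    (F := fun y _ => R F y) (φ := fun _ => 1) (c := K) hq
    ((h.left.measurable hF).comp measurable_fst) measurable_const (by simpa using hlt)
  have hκm' : Measurable fun y => κ y () := hκm.comp measurable_prodMk_right
  rw [lintegral_dirac, mul_one] at hlt
  obtain ⟨k, hk, hk1, hlt⟩ := h.norming_left hF hκm' hlt
  have := hK (fun w => κ (π w) () * k w) ((hκm'.comp h.measurable_proj).mul hk)
  rw [h.right.mul hk hκm'] at this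
  have h2 : lpn r ν (fun y => κ y () * R' k y) ≤ 1 :=
    (lpn_mono hq.symm.nonneg fun y => mul_le_of_le_one_right' (hk1 y)).trans (hκ ())
  refine (hlt.trans_le ?_).not_ge (this.trans (mul_le_of_le_one_right' h2))
  exact lintegral_mono fun w => by dsimp only; rw [mul_assoc, mul_comm (k w)]

/-- Doob's maximal inequality in `L_q(R)`. -/
def MaxBound (μ : Measure W) (ν : Measure Y) (𝓕 : Filtration ℕ mW)
    (R : (W → ℝ≥0∞) → Y → ℝ≥0∞) (q : ℝ) (A : ℝ≥0) : Prop :=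
  ∀ (T : Finset ℕ) (f : W → ℝ≥0∞) (e : ℕ → W → ℝ≥0∞), Measurable f →
    (∀ n ∈ T, CondLE (𝓕 n) μ (e n) f) →
    lpn q ν (R fun w => ⨆ n ∈ T, e n w) ≤ A * lpn q ν (R f)

/-- The dual Doob inequality in `L_q(R)`. -/
def SumBound (μ : Measure W) (ν : Measure Y) (𝓕 : Filtration ℕ mW)
    (R : (W → ℝ≥0∞) → Y → ℝ≥0∞) (q : ℝ) (A : ℝ≥0) : Prop :=
  ∀ (T : Finset ℕ) (g e : ℕ → W → ℝ≥0∞), (∀ n ∈ T, Measurable (g n)) →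
    (∀ n ∈ T, CondLE (𝓕 n) μ (e n) (g n)) →
    lpn q ν (R fun w => ∑ n ∈ T, e n w) ≤ A * lpn q ν (R fun w => ∑ n ∈ T, g n w)

lemma measurable_biSup_finset {m : MeasurableSpace W} {T : Finset ℕ} {e : ℕ → W → ℝ≥0∞}
    (he : ∀ n ∈ T, Measurable[m] (e n)) : Measurable[m] fun w => ⨆ n ∈ T, e n w :=
  Measurable.biSup (T : Set ℕ) T.countable_toSet (f := e) he

lemma CondLE.measurable {m : MeasurableSpace W} (hm : m ≤ mW) {e f : W → ℝ≥0∞}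
    (h : CondLE m μ e f) : Measurable[mW] e := h.1.mono hm le_rfl

lemma lintegral_finsetSum_mul {T : Finset ℕ} {g : ℕ → W → ℝ≥0∞} {k : W → ℝ≥0∞}
    (hg : ∀ n ∈ T, Measurable (g n)) (hk : Measurable k) :
    ∫⁻ w, (∑ n ∈ T, g n w) * k w ∂μ = ∑ n ∈ T, ∫⁻ w, g n w * k w ∂μ := by
  simp only [Finset.sum_mul]
  exact lintegral_finsetSum' _ fun n hn => ((hg n hn).mul hk).aemeasurable

/-- Linearizes the supremum: all of `h` is given to one index where the maximum is attained. -/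
lemma exists_selection {T : Finset ℕ} {e : ℕ → W → ℝ≥0∞} (he : ∀ n ∈ T, Measurable (e n))
    {h : W → ℝ≥0∞} (hh : Measurable h) :
    ∃ k : ℕ → W → ℝ≥0∞, (∀ n ∈ T, Measurable (k n)) ∧ (∀ w, ∑ n ∈ T, k n w ≤ h w) ∧
      ∀ w, (⨆ n ∈ T, e n w) * h w ≤ ∑ n ∈ T, e n w * k n w := by
  classical
  induction T using Finset.induction_on with
  | empty => exact ⟨fun _ _ => 0, by simp, by simp, by simp⟩
  | insert a T ha ih =>
    obtain ⟨k, hk, hk1, hk2⟩ := ih fun n hn => he n (Finset.mem_insert_of_mem hn)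
    have hS : Measurable fun w => ⨆ n ∈ T, e n w :=
      measurable_biSup_finset fun n hn => he n (Finset.mem_insert_of_mem hn)
    have hB : MeasurableSet {w | (⨆ n ∈ T, e n w) ≤ e a w} :=
      measurableSet_le hS (he a (Finset.mem_insert_self a T))
    set B := {w | (⨆ n ∈ T, e n w) ≤ e a w}
    have hne : ∀ n ∈ T, n ≠ a := fun n hn h => ha (h ▸ hn)
    refine ⟨fun n => if n = a then B.indicator h else Bᶜ.indicator (k n), ?_, ?_, ?_⟩
    · intro n hn
      by_cases hna : n = a
      · simpa [hna] using hh.indicator hB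
      · simpa [hna] using
          (hk n ((Finset.mem_insert.1 hn).resolve_left hna)).indicator hB.compl
    · intro w
      rw [Finset.sum_insert ha]
      by_cases hw : w ∈ B
      · rw [Finset.sum_eq_zero fun n hn => by simp [hne n hn, hw]]
        simp [hw]
      · rw [Finset.sum_congr rfl fun n hn => show _ = k n w by simp [hne n hn, hw]]
        simpa [hw] using hk1 w
    · intro w
      rw [Finset.sum_insert ha, Finset.iSup_insert]
      by_cases hw : w ∈ B
      · rw [sup_eq_left.2 hw]
        simp [hw]
      · rw [Finset.sum_congr rfl
          fun n hn => show _ = e n w * k n w by simp [hne n hn, hw],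
          sup_eq_right.2 (not_le.1 hw).le]
        simpa [hw] using hk2 w

/-- The maximal inequality implies the dual one. -/
lemma MaxBound.sumBound [IsFiniteMeasure μ] [IsProbabilityMeasure ν]
    (h : IsFiberNorm π μ ν 𝓕 𝓗 R R') {q r : ℝ} (hq : q.HolderConjugate r) {A : ℝ≥0}
    (hA : MaxBound μ ν 𝓕 R q A) : SumBound μ ν 𝓕 R' r A := by
  intro T g e hg he
  have hem : ∀ n ∈ T, Measurable (e n) := fun n hn => (he n hn).measurable (𝓕.le n)
  have hGm : Measurable fun w => ∑ n ∈ T, g n w := Finset.measurable_fun_sum _ hg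
  refine h.symm.lpn_le_of_forall_pairing hq.symm (Finset.measurable_fun_sum _ hem) fun k hk => ?_
  set E : ℕ → W → ℝ≥0∞ := fun n => condLExp (𝓕 n) μ k
  have hE : ∀ n, CondLE (𝓕 n) μ (E n) k := fun n => condLE_condLExp (𝓕.le n) k
  have hEm : ∀ n, Measurable (E n) := fun n => (hE n).measurable (𝓕.le n)
  have hSm : Measurable fun w => ⨆ n ∈ T, E n w := measurable_biSup_finset fun n _ => hEm n
  -- Conditioning is moved from `g n` onto `k`, whose conditional expectations are bounded by their
  -- maximum.
  calc ∫⁻ w, (∑ n ∈ T, e n w) * k w ∂μ = ∑ n ∈ T, ∫⁻ w, e n w * k w ∂μ :=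
        lintegral_finsetSum_mul hem hk
    _ ≤ ∑ n ∈ T, ∫⁻ w, g n w * E n w ∂μ := Finset.sum_le_sum fun n hn =>
        (lintegral_mul_condLExp (𝓕.le n) (he n hn).1 hk).trans
          ((he n hn).lintegral_mul_le (𝓕.le n) (hg n hn) (hE n).1)
    _ ≤ ∑ n ∈ T, ∫⁻ w, g n w * ⨆ n ∈ T, E n w ∂μ := by
        refine Finset.sum_le_sum fun n hn => lintegral_mono fun w => ?_
        dsimp only
        gcongr
        exact le_iSup₂ (f := fun n (_ : n ∈ T) => E n w) n hn
    _ = ∫⁻ w, (∑ n ∈ T, g n w) * ⨆ n ∈ T, E n w ∂μ :=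
        (lintegral_finsetSum_mul hg hSm).symm
    _ ≤ ∫⁻ y, R' (fun w => ∑ n ∈ T, g n w) y * R (fun w => ⨆ n ∈ T, E n w) y ∂ν :=
        h.symm.holder hGm hSm
    _ ≤ lpn r ν (R' fun w => ∑ n ∈ T, g n w) * lpn q ν (R fun w => ⨆ n ∈ T, E n w) :=
        lintegral_mul_le_lpn hq.symm (h.right.measurable hGm) (h.left.measurable hSm)
    _ ≤ lpn r ν (R' fun w => ∑ n ∈ T, g n w) * (A * lpn q ν (R k)) := by
        gcongr
        exact hA T k E hk fun n _ => hE n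
    _ = _ := by ring

/-- The dual Doob inequality implies the maximal inequality. -/
lemma SumBound.maxBound [IsFiniteMeasure μ] [IsProbabilityMeasure ν]
    (h : IsFiberNorm π μ ν 𝓕 𝓗 R R') {q r : ℝ} (hq : q.HolderConjugate r) {A : ℝ≥0}
    (hA : SumBound μ ν 𝓕 R' r A) : MaxBound μ ν 𝓕 R q A := by
  intro T f e hf he
  have hem : ∀ n ∈ T, Measurable (e n) := fun n hn => (he n hn).measurable (𝓕.le n)
  refine h.lpn_le_of_forall_pairing hq (measurable_biSup_finset hem) fun h' hh' => ?_
  obtain ⟨k, hk, hk1, hk2⟩ := exists_selection hem hh'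
  set E : ℕ → W → ℝ≥0∞ := fun n => condLExp (𝓕 n) μ (k n)
  have hE : ∀ n, CondLE (𝓕 n) μ (E n) (k n) := fun n => condLE_condLExp (𝓕.le n) (k n)
  have hEm : ∀ n, Measurable (E n) := fun n => (hE n).measurable (𝓕.le n)
  have hSm : Measurable fun w => ∑ n ∈ T, E n w := Finset.measurable_fun_sum _ fun n _ => hEm n
  calc ∫⁻ w, (⨆ n ∈ T, e n w) * h' w ∂μ ≤ ∫⁻ w, ∑ n ∈ T, e n w * k n w ∂μ :=
        lintegral_mono hk2
    _ = ∑ n ∈ T, ∫⁻ w, e n w * k n w ∂μ :=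
        lintegral_finsetSum' _ fun n hn => ((hem n hn).mul (hk n hn)).aemeasurable
    _ ≤ ∑ n ∈ T, ∫⁻ w, f w * E n w ∂μ := Finset.sum_le_sum fun n hn =>
        (lintegral_mul_condLExp (𝓕.le n) (he n hn).1 (hk n hn)).trans
          ((he n hn).lintegral_mul_le (𝓕.le n) hf (hE n).1)
    _ = ∫⁻ w, f w * ∑ n ∈ T, E n w ∂μ := by
        simp only [mul_comm (f _)]
        exact (lintegral_finsetSum_mul (fun n _ => hEm n) hf).symm
    _ ≤ ∫⁻ y, R f y * R' (fun w => ∑ n ∈ T, E n w) y ∂ν := h.holder hf hSm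
    _ ≤ lpn q ν (R f) * lpn r ν (R' fun w => ∑ n ∈ T, E n w) :=
        lintegral_mul_le_lpn hq (h.left.measurable hf) (h.right.measurable hSm)
    _ ≤ lpn q ν (R f) * (A * lpn r ν (R' h')) := by
        gcongr
        refine (hA T k E hk fun n _ => hE n).trans ?_
        gcongr
        exact lpn_mono hq.symm.nonneg (h.right.mono hk1)
    _ = _ := by ring

/-- The dual Doob inequality for scalar functions. -/
lemma sumBound_id [IsProbabilityMeasure ν] {r : ℝ} (hr : 1 < r) :
    SumBound ν ν 𝓗 (fun f => f) r r.toNNReal := by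
  intro T g e hg he
  have hem : ∀ n ∈ T, Measurable (e n) := fun n hn => (he n hn).measurable (𝓗.le n)
  have hp : IsTimeFamily 𝓗 T fun S y => ∑ n ∈ S, e n y := by
    refine ⟨fun n => ?_, fun n => ?_, fun S S' hS _ y => ?_, fun n y => ?_⟩
    · refine Finset.measurable_fun_sum _ fun k hk => ?_
      rw [Finset.mem_filter] at hk
      exact (he k hk.1).1.mono (𝓗.mono hk.2) le_rfl
    · exact Finset.measurable_fun_sum _ fun k hk => hem k (Finset.mem_filter.1 hk).1
    · exact Finset.sum_le_sum_of_subset hS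
    · rw [← Finset.sum_filter_add_sum_filter_not T (· ≤ n)]
      simp only [not_le, Nat.succ_le_iff]
      exact le_rfl
  -- For `k ≥ n`, events of `𝓗 n` lie in `𝓗 k`, so the tail sum of the `e k` is conditionally
  -- dominated by the full sum of the `g k`.
  refine hp.lpn_le hr (Finset.measurable_fun_sum _ hg) fun n _ s hs => ?_
  rw [lintegral_finsetSum' _ fun k hk => (hem k (Finset.mem_filter.1 hk).1).aemeasurable,
    lintegral_finsetSum' _ fun k hk => (hg k hk).aemeasurable]
  refine (Finset.sum_le_sum fun k hk => ?_).trans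
    (Finset.sum_le_sum_of_subset (Finset.filter_subset (n ≤ ·) T))
  rw [Finset.mem_filter] at hk
  exact (he k hk.1).2 s (𝓗.mono hk.2 s hs)

/-- **Doob's maximal inequality** for scalar functions. -/
lemma maxBound_id [IsProbabilityMeasure ν] {r : ℝ} (hr : 1 < r) :
    MaxBound ν ν 𝓗 (fun f => f) r r.conjExponent.toNNReal :=
  (sumBound_id (Real.HolderConjugate.conjExponent hr).symm.lt).maxBound (isFiberNorm_id ν 𝓗)
    (Real.HolderConjugate.conjExponent hr)

/-- The constant in the extrapolation from the exponent `s` to the exponent `r`. -/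
noncomputable def extrapConst (A : ℝ≥0) (s r : ℝ) : ℝ≥0 :=
  r.toNNReal * (A * (r / s).conjExponent.toNNReal ^ (1 / s))

/-- Extrapolation to larger exponents. -/
lemma IsTimeFamily.lpn_le_extrapConst [IsProbabilityMeasure ν] {T : Finset ℕ}
    {Φ : Finset ℕ → Y → ℝ≥0∞} (h : IsTimeFamily 𝓗 T Φ) {s r : ℝ} (hs : 1 < s) (hr : s < r)
    {G : Y → ℝ≥0∞} (hG : Measurable G) {A : ℝ≥0}
    (hΦ : ∀ n, ∀ B, MeasurableSet[𝓗 n] B →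
      ∫⁻ y in B, Φ (T.filter (n ≤ ·)) y ^ s ∂ν ≤ ∫⁻ y in B, (A * G y) ^ s ∂ν) :
    lpn r ν (Φ T) ≤ extrapConst A s r * lpn r ν G := by
  classical
  have hs0 : 0 < s := by linarith
  have hr0 : 0 < r := by linarith
  set U : ℕ → Y → ℝ≥0∞ := fun n => condLExp (𝓗 n) ν fun y => G y ^ s
  have hUm : ∀ n, Measurable[𝓗 n] (U n) := fun n => measurable_condLExp _ _ _
  have hUm' : ∀ n, Measurable (U n) := fun n => (hUm n).mono (𝓗.le n) le_rfl
  set T' := Finset.range (T.sup id + 1)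
  set M : Y → ℝ≥0∞ := fun y => ⨆ n ∈ T', U n y
  have hMm : Measurable M := measurable_biSup_finset fun n _ => hUm' n
  have hMs : Measurable fun y => M y ^ (1 / s) := hMm.pow_const _
  -- Jensen turns the conditional `s`-th moment bound into a first moment bound by `A * M ^ (1 /
  -- s)`, with `M` the maximal function of `G ^ s`. Garsia then applies, and `M` is controlled by
  -- scalar Doob in `L_{r/s}`, where `r / s > 1`.
  have key : lpn r ν (Φ T) ≤ ENNReal.ofReal r * lpn r ν fun y => A * M y ^ (1 / s) := by
    refine h.lpn_le (by linarith) (hMs.const_mul _) fun n hn B hB => ?_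
    have hφm : Measurable[𝓗 n] fun y => A * U n y ^ (1 / s) := ((hUm n).pow_const _).const_mul _
    refine (setLIntegral_le_of_rpow_le (𝓗.le n) hs (h.measurable n) hφm (fun B hB => ?_)
      hB).trans ?_
    · refine (hΦ n B hB).trans ?_
      simp only [ENNReal.mul_rpow_of_nonneg _ _ hs0.le, ← ENNReal.rpow_mul,
        one_div_mul_cancel hs0.ne', ENNReal.rpow_one]
      rw [lintegral_const_mul _ (hG.pow_const _), lintegral_const_mul _ (hUm' n),
        setLIntegral_condLExp (𝓗.le n) _ _ hB]
    · refine lintegral_mono fun y => ?_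
      dsimp only
      gcongr
      exact le_iSup₂ (f := fun n (_ : n ∈ T') => U n y) n (Finset.mem_range.2 (Nat.lt_succ_of_le hn))
  refine key.trans ?_
  have hD := maxBound_id (ν := ν) (𝓗 := 𝓗) (r := r / s) ((one_lt_div hs0).2 hr) T'
    (fun y => G y ^ s) U (hG.pow_const _) fun n _ => condLE_condLExp (𝓗.le n) _
  have h2 : lpn (r / s) ν (fun y => G y ^ s) ^ (1 / s) = lpn r ν G := by
    rw [← lpn_rpow_comp hs0 hr0]
    simp only [← ENNReal.rpow_mul, mul_one_div_cancel hs0.ne', ENNReal.rpow_one]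
  rw [lpn_const_mul hr0 _ hMs, lpn_rpow_comp hs0 hr0]
  have h3 := ENNReal.rpow_le_rpow hD (by positivity : 0 ≤ 1 / s)
  rw [ENNReal.mul_rpow_of_nonneg _ _ (by positivity), h2] at h3
  calc ENNReal.ofReal r * (A * lpn (r / s) ν M ^ (1 / s))
      ≤ ENNReal.ofReal r * (A * ((r / s).conjExponent.toNNReal ^ (1 / s) * lpn r ν G)) := by
        gcongr
    _ = extrapConst A s r * lpn r ν G := by
        rw [extrapConst, ENNReal.coe_mul, ENNReal.coe_mul,
          ENNReal.coe_rpow_of_nonneg _ (by positivity : 0 ≤ 1 / s), ENNReal.ofReal]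
        ring

end FiberNorm

/-! ### Changing the outer exponent. -/

section Extrapolation

variable {W Y : Type*} {mW : MeasurableSpace W} {mY : MeasurableSpace Y}
  {π : W → Y} {μ : Measure W} {ν : Measure Y} {𝓕 : Filtration ℕ mW} {𝓗 : Filtration ℕ mY}
  {R R' : (W → ℝ≥0∞) → Y → ℝ≥0∞}

lemma lpn_indicator_mul_rpow {s : ℝ} (hs : 0 < s) {B : Set Y} (hB : MeasurableSet B)
    (g : Y → ℝ≥0∞) :
    lpn s ν (fun y => B.indicator 1 y * g y) ^ s = ∫⁻ y in B, g y ^ s ∂ν := by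
  rw [lpn_rpow hs, ← lintegral_indicator hB]
  congr 1 with y
  by_cases hy : y ∈ B <;> simp [hy, hs]

/-- Localization: a norm inequality for functions cut off to `B` is an inequality of integrals over
`B`. -/
lemma setLIntegral_rpow_le_of_lpn_le {s : ℝ} (hs : 0 < s) {B : Set Y} (hB : MeasurableSet B)
    {V G : Y → ℝ≥0∞} (hG : Measurable G) {A : ℝ≥0}
    (h : lpn s ν (fun y => B.indicator 1 y * V y) ≤ A * lpn s ν fun y => B.indicator 1 y * G y) :
    ∫⁻ y in B, V y ^ s ∂ν ≤ ∫⁻ y in B, (A * G y) ^ s ∂ν := by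
  rw [← lpn_indicator_mul_rpow hs hB, ← lpn_indicator_mul_rpow hs hB]
  refine ENNReal.rpow_le_rpow (h.trans_eq ?_) hs.le
  have hBG : Measurable fun y => B.indicator 1 y * G y := (measurable_one.indicator hB).mul hG
  rw [← lpn_const_mul hs _ hBG]
  congr 1 with y
  ring

lemma biSup_mul_left (T : Finset ℕ) (a : ℝ≥0∞) (e : ℕ → ℝ≥0∞) :
    ⨆ n ∈ T, a * e n = a * ⨆ n ∈ T, e n := by
  simp only [ENNReal.mul_iSup]

/-- For `B ∈ 𝓗 n`, the pullback of its indicator under `π` is `𝓕 k`-measurable for all `k ≥ n`.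
Multiplying by it preserves `CondLE`, so the `L_s` bound also holds conditionally on `𝓗 n`. -/
lemma MaxBound.extrapolate [IsProbabilityMeasure ν] (hπ : Measurable π)
    (hπn : ∀ n, Measurable[𝓕 n, 𝓗 n] π) (h : FiberLaws π 𝓕 𝓗 R) {s r : ℝ} (hs : 1 < s)
    (hr : s < r) {A : ℝ≥0} (hA : MaxBound μ ν 𝓕 R s A) :
    MaxBound μ ν 𝓕 R r (extrapConst A s r) := by
  intro T f e hf he
  have hs0 : 0 < s := by linarith
  have hem : ∀ n ∈ T, Measurable (e n) := fun n hn => (he n hn).measurable (𝓕.le n)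
  have hSm : ∀ S ⊆ T, Measurable fun w => ⨆ n ∈ S, e n w := fun S hS =>
    measurable_biSup_finset fun n hn => hem n (hS hn)
  have hp : IsTimeFamily 𝓗 T fun S => R fun w => ⨆ n ∈ S, e n w := by
    refine ⟨fun n => h.adapted n ?_, fun n => h.measurable ?_, fun S S' hS _ y => ?_,
      fun n y => ?_⟩
    · refine measurable_biSup_finset fun k hk => ?_
      rw [Finset.mem_filter] at hk
      exact (he k hk.1).1.mono (𝓕.mono hk.2) le_rfl
    · exact hSm _ (Finset.filter_subset _ _)
    · exact h.mono (fun w => biSup_mono fun n hn => hS hn) y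
    · refine (h.mono (fun w => ?_) y).trans (h.add (hSm _ (Finset.filter_subset (· ≤ n) T))
        (hSm _ (Finset.filter_subset (n + 1 ≤ ·) T)) y)
      refine iSup₂_le fun k hk => ?_
      rcases le_or_gt k n with hkn | hkn
      · exact (le_iSup₂ (f := fun k (_ : k ∈ T.filter (· ≤ n)) => e k w) k
          (Finset.mem_filter.2 ⟨hk, hkn⟩)).trans le_self_add
      · exact (le_iSup₂ (f := fun k (_ : k ∈ T.filter (n + 1 ≤ ·)) => e k w) k
          (Finset.mem_filter.2 ⟨hk, hkn⟩)).trans le_add_self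
  refine hp.lpn_le_extrapConst hs hr (h.measurable hf) fun n B hB => ?_
  have hB' := 𝓗.le n B hB
  have hind : Measurable (B.indicator (1 : Y → ℝ≥0∞)) := measurable_one.indicator hB'
  have hindn : Measurable[𝓗 n] (B.indicator (1 : Y → ℝ≥0∞)) :=
    (@measurable_const _ _ _ (𝓗 n) 1).indicator hB
  refine setLIntegral_rpow_le_of_lpn_le hs0 hB' (h.measurable hf) ?_
  rw [← h.mul (hSm _ (Finset.filter_subset _ _)) hind, ← h.mul hf hind]
  simp only [← biSup_mul_left]
  refine hA _ _ _ ((hind.comp hπ).mul hf) fun k hk => ?_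
  rw [Finset.mem_filter] at hk
  exact (he k hk.1).mul (𝓕.le k) hf ((hindn.comp (hπn n)).mono (𝓕.mono hk.2) le_rfl)

lemma SumBound.extrapolate [IsProbabilityMeasure ν] (hπ : Measurable π)
    (hπn : ∀ n, Measurable[𝓕 n, 𝓗 n] π) (h : FiberLaws π 𝓕 𝓗 R) {s r : ℝ} (hs : 1 < s)
    (hr : s < r) {A : ℝ≥0} (hA : SumBound μ ν 𝓕 R s A) :
    SumBound μ ν 𝓕 R r (extrapConst A s r) := by
  intro T g e hg he
  have hs0 : 0 < s := by linarith
  have hem : ∀ n ∈ T, Measurable (e n) := fun n hn => (he n hn).measurable (𝓕.le n)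
  have hSm : ∀ S ⊆ T, Measurable fun w => ∑ n ∈ S, e n w := fun S hS =>
    Finset.measurable_fun_sum _ fun n hn => hem n (hS hn)
  have hgm : ∀ S ⊆ T, Measurable fun w => ∑ n ∈ S, g n w := fun S hS =>
    Finset.measurable_fun_sum _ fun n hn => hg n (hS hn)
  have hG := h.measurable (hgm T subset_rfl)
  have hp : IsTimeFamily 𝓗 T fun S => R fun w => ∑ n ∈ S, e n w := by
    refine ⟨fun n => h.adapted n ?_, fun n => h.measurable ?_, fun S S' hS _ y => ?_,
      fun n y => ?_⟩
    · refine Finset.measurable_fun_sum _ fun k hk => ?_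
      rw [Finset.mem_filter] at hk
      exact (he k hk.1).1.mono (𝓕.mono hk.2) le_rfl
    · exact hSm _ (Finset.filter_subset _ _)
    · exact h.mono (fun w => Finset.sum_le_sum_of_subset hS) y
    · refine (h.mono (fun w => ?_) y).trans (h.add (hSm _ (Finset.filter_subset (· ≤ n) T))
        (hSm _ (Finset.filter_subset (n + 1 ≤ ·) T)) y)
      rw [← Finset.sum_filter_add_sum_filter_not T (· ≤ n)]
      simp only [not_le, Nat.succ_le_iff]
      exact le_rfl
  refine hp.lpn_le_extrapConst hs hr hG fun n B hB => ?_
  have hB' := 𝓗.le n B hB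
  have hind : Measurable (B.indicator (1 : Y → ℝ≥0∞)) := measurable_one.indicator hB'
  have hindn : Measurable[𝓗 n] (B.indicator (1 : Y → ℝ≥0∞)) :=
    (@measurable_const _ _ _ (𝓗 n) 1).indicator hB
  have hsub := Finset.filter_subset (n ≤ ·) T
  refine setLIntegral_rpow_le_of_lpn_le hs0 hB' hG ?_
  calc lpn s ν (fun y => B.indicator 1 y * R (fun w => ∑ k ∈ T.filter (n ≤ ·), e k w) y)
      ≤ A * lpn s ν fun y => B.indicator 1 y * R (fun w => ∑ k ∈ T.filter (n ≤ ·), g k w) y := by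
        rw [← h.mul (hSm _ hsub) hind, ← h.mul (hgm _ hsub) hind]
        simp only [Finset.mul_sum]
        refine hA _ (fun k w => B.indicator 1 (π w) * g k w)
          (fun k w => B.indicator 1 (π w) * e k w) (fun k hk => ?_) fun k hk => ?_
        · exact (hind.comp hπ).mul (hg k (hsub hk))
        · rw [Finset.mem_filter] at hk
          exact (he k hk.1).mul (𝓕.le k) (hg k hk.1)
            ((hindn.comp (hπn n)).mono (𝓕.mono hk.2) le_rfl)
    -- The tail is enlarged to the whole sum, because the dominating function must not depend on
    -- `n`.
    _ ≤ A * lpn s ν fun y => B.indicator 1 y * R (fun w => ∑ k ∈ T, g k w) y := by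
        gcongr
        refine lpn_mono hs0.le fun y => ?_
        gcongr
        exact h.mono (fun w => Finset.sum_le_sum_of_subset hsub) y

/-- The constant in the extrapolation from the exponent `s` to an arbitrary exponent `r`. -/
noncomputable def extrapConst' (A : ℝ≥0) (s r : ℝ) : ℝ≥0 :=
  max A (max (extrapConst A s r) (extrapConst A s.conjExponent r.conjExponent))

lemma MaxBound.mono {q : ℝ} {A B : ℝ≥0} (hA : MaxBound μ ν 𝓕 R q A) (h : A ≤ B) :
    MaxBound μ ν 𝓕 R q B := fun T f e hf he =>
  (hA T f e hf he).trans (by gcongr)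

lemma conjExponent_lt {s r : ℝ} (hs : 1 < s) (hr : s < r) : r.conjExponent < s.conjExponent := by
  have h1 := (Real.HolderConjugate.conjExponent hs)
  have h2 := (Real.HolderConjugate.conjExponent (hs.trans hr))
  have e1 := h1.inv_add_inv_eq_one
  have e2 := h2.inv_add_inv_eq_one
  have := (inv_lt_inv₀ (by linarith : 0 < r) (by linarith)).2 hr
  exact (inv_lt_inv₀ h1.symm.pos h2.symm.pos).1 (by linarith)

/-- The maximal inequality in `L_s(R)` for one exponent implies it for all exponents. -/
lemma MaxBound.extrapolate_all [IsFiniteMeasure μ] [IsProbabilityMeasure ν]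
    (h : IsFiberNorm π μ ν 𝓕 𝓗 R R') {s r : ℝ} (hs : 1 < s) (hr : 1 < r) {A : ℝ≥0}
    (hA : MaxBound μ ν 𝓕 R s A) : MaxBound μ ν 𝓕 R r (extrapConst' A s r) := by
  rcases lt_trichotomy s r with hsr | rfl | hsr
  · exact (hA.extrapolate h.measurable_proj h.adapted_proj h.left hs hsr).mono
      ((le_max_left _ _).trans (le_max_right _ _))
  · exact hA.mono (le_max_left _ _)
  -- Conjugation reverses the order of exponents, so lowering `s` to `r` is raising the conjugate
  -- exponent in the dual inequality.
  · have h1 := hA.sumBound h (Real.HolderConjugate.conjExponent hs)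
    have h2 := h1.extrapolate h.measurable_proj h.adapted_proj h.right
      (Real.HolderConjugate.conjExponent hs).symm.lt (conjExponent_lt hr hsr)
    exact (h2.maxBound h (Real.HolderConjugate.conjExponent hr)).mono
      ((le_max_right _ _).trans (le_max_right _ _))

end Extrapolation

/-! ### Absorbing one more variable into the fibre norm. -/

section Lift

universe u

variable {d : ℕ} {Ω : Fin (d + 1) → Type u}

/-- The first variable, which is integrated out, may carry its full σ-algebra while the others carry
only that of time `n`; adaptedness of `liftNorm` uses this. -/
lemma measurable_finCons (m : ∀ i, MeasurableSpace (Ω i)) {m0 : MeasurableSpace (Ω 0)}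
    (h0 : m 0 ≤ m0) :
    @Measurable _ _ (m0.prod (@MeasurableSpace.pi (Fin d) (fun i => Ω i.succ) fun i => m i.succ))
      (@MeasurableSpace.pi _ _ m)
      (fun z : Ω 0 × (∀ i : Fin d, Ω i.succ) => (Fin.cons z.1 z.2 : ∀ i, Ω i)) := by
  let _ := m0
  let _ : ∀ i : Fin d, MeasurableSpace (Ω i.succ) := fun i => m i.succ
  refine @measurable_pi_lambda _ _ _ _ m _ fun i => ?_
  refine Fin.cases ?_ (fun j => ?_) i
  · exact measurable_fst.mono le_rfl h0
  · exact (measurable_pi_apply j).comp measurable_snd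

lemma measurable_finTail (m : ∀ i, MeasurableSpace (Ω i)) :
    @Measurable _ _ (@MeasurableSpace.pi _ _ m)
      (@MeasurableSpace.pi (Fin d) (fun i => Ω i.succ) fun i => m i.succ)
      (fun z : ∀ i, Ω i => fun i : Fin d => z i.succ) :=
  measurable_pi_lambda _ fun i => measurable_pi_apply i.succ

variable [mΩ : ∀ i, MeasurableSpace (Ω i)] {P : ∀ i, Measure (Ω i)}

lemma lintegral_pi_succ [∀ i, IsProbabilityMeasure (P i)] {g : (∀ i, Ω i) → ℝ≥0∞}
    (hg : Measurable g) :
    ∫⁻ z, g z ∂Measure.pi P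
      = ∫⁻ y, ∫⁻ x, g (Fin.cons x y) ∂P 0 ∂Measure.pi fun i : Fin d => P i.succ := by
  have h := (measurePreserving_piFinSuccAbove P 0).symm
  rw [← h.lintegral_comp hg]
  simp_rw [MeasurableEquiv.piFinSuccAbove_symm_apply, Fin.insertNthEquiv, Equiv.coe_fn_mk,
    Fin.insertNth_zero]
  exact lintegral_prod_symm' (μ := P 0) (ν := Measure.pi fun i : Fin d => P i.succ)
    (fun z : Ω 0 × (∀ i : Fin d, Ω i.succ) => g (Fin.cons z.1 z.2))
    (hg.comp (measurable_finCons mΩ le_rfl))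

variable {W : Type*} {mW : MeasurableSpace W} {μ : Measure W} {𝓕 : Filtration ℕ mW}
  {F : ∀ i, Filtration ℕ (mΩ i)} {π : W → ∀ i, Ω i} {R R' : (W → ℝ≥0∞) → (∀ i, Ω i) → ℝ≥0∞}

/-- The norm obtained from a norm depending on `d + 1` variables by taking the `L_q` norm in the
first one. -/
noncomputable def liftNorm (q : ℝ) (P : ∀ i, Measure (Ω i))
    (R : (W → ℝ≥0∞) → (∀ i, Ω i) → ℝ≥0∞) (f : W → ℝ≥0∞) (y : ∀ i : Fin d, Ω i.succ) : ℝ≥0∞ :=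
  lpn q (P 0) fun x => R f (Fin.cons x y)

/-- Tonelli: equal inner and outer exponents merge into one `L_q` norm on the product. -/
lemma lpn_liftNorm [∀ i, IsProbabilityMeasure (P i)] {q : ℝ} (hq : 0 < q) {f : W → ℝ≥0∞}
    (hf : Measurable (R f)) :
    lpn q (Measure.pi fun i : Fin d => P i.succ) (liftNorm q P R f)
      = lpn q (Measure.pi P) (R f) := by
  unfold liftNorm lpn
  rw [lintegral_pi_succ (hf.pow_const _)]
  simp only [← ENNReal.rpow_mul, one_div_mul_cancel hq.ne', ENNReal.rpow_one]

/-- Fubini: the maximal inequality in `L_q(R)` is one in `L_q(L_q(R))`. -/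
lemma MaxBound.lift [∀ i, IsProbabilityMeasure (P i)]
    (h : FiberLaws π 𝓕 (prodFiltration F) R) {q : ℝ} (hq : 0 < q) {A : ℝ≥0}
    (hA : MaxBound μ (Measure.pi P) 𝓕 R q A) :
    MaxBound μ (Measure.pi fun i : Fin d => P i.succ) 𝓕 (liftNorm q P R) q A := by
  intro T f e hf he
  rw [lpn_liftNorm hq (h.measurable hf), lpn_liftNorm hq (h.measurable ?_)]
  · exact hA T f e hf he
  · exact measurable_biSup_finset fun n hn => (he n hn).measurable (𝓕.le n)

lemma FiberLaws.lift [∀ i, IsProbabilityMeasure (P i)]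
    (h : FiberLaws π 𝓕 (prodFiltration F) R) {q : ℝ} (hq : 1 < q) :
    FiberLaws (fun w (i : Fin d) => π w i.succ) 𝓕 (prodFiltration fun i : Fin d => F i.succ)
      (liftNorm q P R) := by
  have hq0 : 0 < q := by linarith
  have hcons : ∀ y : ∀ i : Fin d, Ω i.succ, Measurable fun x : Ω 0 => (Fin.cons x y : ∀ i, Ω i) :=
    fun y => (measurable_finCons mΩ le_rfl).comp measurable_prodMk_right
  refine ⟨fun hfg y => lpn_mono hq0.le fun x => h.mono hfg _, fun {f g} hf hg y => ?_,
    fun {f φ} hf hφ => ?_, fun hf => ?_, fun n f hf => ?_⟩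
  · exact (lpn_mono hq0.le fun x => h.add hf hg _).trans
      (lpn_add_le hq.le ((h.measurable hf).comp (hcons y)) ((h.measurable hg).comp (hcons y)))
  · ext y
    unfold liftNorm
    have := h.mul (φ := fun z => φ fun i => z i.succ) hf (hφ.comp (measurable_finTail mΩ))
    rw [this]
    simp only [Fin.cons_succ]
    exact lpn_const_mul hq0 _ ((h.measurable hf).comp (hcons y))
  · exact (Measurable.lintegral_prod_left'
      (((h.measurable hf).comp (measurable_finCons mΩ le_rfl)).pow_const q)).pow_const _
  · let m : ∀ i : Fin d, MeasurableSpace (Ω i.succ) := fun i => F i.succ n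
    exact (Measurable.lintegral_prod_left'
      (((h.adapted n hf).comp (measurable_finCons (fun i => F i n) ((F 0).le n))).pow_const
        q)).pow_const _

/-- Norming in two stages: `κ` for the `L_q` norm in the first variable, then `k` for `R` with
weight `κ φ`. The product `κ k` is the required function. -/
lemma IsFiberNorm.lift_norming [∀ i, IsProbabilityMeasure (P i)]
    (h : IsFiberNorm π μ (Measure.pi P) 𝓕 (prodFiltration F) R R') {q r : ℝ}
    (hq : q.HolderConjugate r) {f : W → ℝ≥0∞} {φ : (∀ i : Fin d, Ω i.succ) → ℝ≥0∞} {c : ℝ≥0∞}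
    (hf : Measurable f) (hφ : Measurable φ)
    (hc : c < ∫⁻ y, liftNorm q P R f y * φ y ∂Measure.pi fun i : Fin d => P i.succ) :
    ∃ k : W → ℝ≥0∞, Measurable k ∧ (∀ y, liftNorm r P R' k y ≤ 1) ∧
      c < ∫⁻ w, f w * k w * φ (fun i => π w i.succ) ∂μ := by
  have hRf := h.left.measurable hf
  obtain ⟨κ, hκ, hκ1, hlt⟩ := lpn_norming (P 0) hq (F := fun x y => R f (Fin.cons x y))
    (hRf.comp (measurable_finCons mΩ le_rfl)) hφ hc
  have hκ' : Measurable fun z : ∀ i, Ω i => κ (z 0) fun i => z i.succ :=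
    hκ.comp ((measurable_pi_apply 0).prodMk (measurable_finTail mΩ))
  have hφ' : Measurable fun z : ∀ i, Ω i => φ fun i => z i.succ := hφ.comp (measurable_finTail mΩ)
  have hκφ : Measurable fun z : ∀ i, Ω i =>
    κ (z 0) (fun i => z i.succ) * φ fun i => z i.succ := hκ'.mul hφ'
  have hRκφ : Measurable fun z : ∀ i, Ω i =>
    R f z * (κ (z 0) (fun i => z i.succ) * φ fun i => z i.succ) := hRf.mul hκφ
  have hlt' : c < ∫⁻ z, R f z * (κ (z 0) (fun i => z i.succ) * φ fun i => z i.succ)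
      ∂Measure.pi P := by
    refine hlt.trans_eq ?_
    rw [lintegral_pi_succ hRκφ]
    congr 1 with y
    simp only [Fin.cons_zero, Fin.cons_succ, ← mul_assoc]
    rw [lintegral_mul_const]
    have hc : Measurable fun x : Ω 0 => (x, y) := measurable_prodMk_right
    exact (hRf.comp ((measurable_finCons mΩ le_rfl).comp hc)).mul (hκ.comp hc)
  obtain ⟨k, hk, hk1, hlt⟩ := h.norming_left hf hκφ hlt'
  refine ⟨fun w => κ (π w 0) (fun i => π w i.succ) * k w,
    (hκ'.comp h.measurable_proj).mul hk, fun y => ?_, hlt.trans_eq ?_⟩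
  · refine le_trans ?_ (hκ1 y)
    unfold liftNorm
    rw [h.right.mul hk hκ']
    refine lpn_mono hq.symm.nonneg fun x => ?_
    simpa using mul_le_of_le_one_right' (hk1 _)
  · congr 1 with w
    ring

/-- Taking the `L_q` norm in one more variable preserves fibre norms. -/
lemma IsFiberNorm.lift [∀ i, IsProbabilityMeasure (P i)]
    (h : IsFiberNorm π μ (Measure.pi P) 𝓕 (prodFiltration F) R R') {q r : ℝ}
    (hq : q.HolderConjugate r) :
    IsFiberNorm (fun w (i : Fin d) => π w i.succ) μ (Measure.pi fun i : Fin d => P i.succ) 𝓕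
      (prodFiltration fun i : Fin d => F i.succ) (liftNorm q P R) (liftNorm r P R') where
  measurable_proj := (measurable_finTail mΩ).comp h.measurable_proj
  adapted_proj n := (measurable_finTail fun i => F i n).comp (h.adapted_proj n)
  left := h.left.lift hq.lt
  right := h.right.lift hq.symm.lt
  holder {f g} hf hg := by
    have hRf := h.left.measurable hf
    have hRg := h.right.measurable hg
    refine (h.holder hf hg).trans ?_
    have hRR : Measurable fun z => R f z * R' g z := hRf.mul hRg
    rw [lintegral_pi_succ hRR]
    refine lintegral_mono fun y => ?_
    have hc : Measurable fun x : Ω 0 => (x, y) := measurable_prodMk_right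
    have hc' := (measurable_finCons mΩ le_rfl).comp hc
    exact lintegral_mul_le_lpn hq (hRf.comp hc') (hRg.comp hc')
  norming_left := h.lift_norming hq
  norming_right := h.symm.lift_norming hq.symm

end Lift

/-! ### Hölder, norming and Doob for mixed norms. -/

section Mixed

universe u v

lemma mixedENorm_succ {d : ℕ} {p : Fin (d + 1) → ℝ≥0∞} (hp : 1 < (p 0).toReal)
    {Ω : Fin (d + 1) → Type u} [mΩ : ∀ i, MeasurableSpace (Ω i)] (P : ∀ i, Measure (Ω i))
    {W : Type v} (R : (W → ℝ≥0∞) → (∀ i, Ω i) → ℝ≥0∞) (f : W → ℝ≥0∞) :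
    mixedENorm (d + 1) p Ω P (R f) = mixedENorm d (fun i => p i.succ) (fun i => Ω i.succ)
      (fun i => P i.succ) (liftNorm (p 0).toReal P R f) := by
  have h0 : p 0 ≠ 0 := fun h => by simp [h] at hp; linarith
  have hi : p 0 ≠ ∞ := fun h => by simp [h] at hp; linarith
  rw [mixedENorm]
  congr 1 with y
  rw [eLpNorm_eq_lintegral_rpow_enorm_toReal h0 hi]
  rfl

/-- Stated for an arbitrary fibre norm so that induction on `d` can absorb the innermost variable
into `R`. At `d = 0` the base is a single point. -/
lemma mixed_holder (d : ℕ) {p p' : Fin d → ℝ≥0∞}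
    (hp : ∀ i, (p i).toReal.HolderConjugate (p' i).toReal)
    {Ω : Fin d → Type u} [mΩ : ∀ i, MeasurableSpace (Ω i)] {P : ∀ i, Measure (Ω i)}
    [∀ i, IsProbabilityMeasure (P i)] {F : ∀ i, Filtration ℕ (mΩ i)}
    {W : Type v} {mW : MeasurableSpace W} {μ : Measure W} {𝓕 : Filtration ℕ mW}
    {π : W → ∀ i, Ω i} {R R' : (W → ℝ≥0∞) → (∀ i, Ω i) → ℝ≥0∞}
    (h : IsFiberNorm π μ (Measure.pi P) 𝓕 (prodFiltration F) R R') {f g : W → ℝ≥0∞}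
    (hf : Measurable f) (hg : Measurable g) :
    ∫⁻ w, f w * g w ∂μ ≤ mixedENorm d p Ω P (R f) * mixedENorm d p' Ω P (R' g) := by
  induction d with
  | zero =>
    refine (h.holder hf hg).trans_eq ?_
    rw [Measure.pi_of_empty P finZeroElim, lintegral_dirac]
    rfl
  | succ d ih =>
    rw [mixedENorm_succ (hp 0).lt, mixedENorm_succ (hp 0).symm.lt]
    exact ih (fun i => hp i.succ) (h.lift (hp 0))

lemma mixed_norming (d : ℕ) {p p' : Fin d → ℝ≥0∞}
    (hp : ∀ i, (p i).toReal.HolderConjugate (p' i).toReal)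
    {Ω : Fin d → Type u} [mΩ : ∀ i, MeasurableSpace (Ω i)] {P : ∀ i, Measure (Ω i)}
    [∀ i, IsProbabilityMeasure (P i)] {F : ∀ i, Filtration ℕ (mΩ i)}
    {W : Type v} {mW : MeasurableSpace W} {μ : Measure W} {𝓕 : Filtration ℕ mW}
    {π : W → ∀ i, Ω i} {R R' : (W → ℝ≥0∞) → (∀ i, Ω i) → ℝ≥0∞}
    (h : IsFiberNorm π μ (Measure.pi P) 𝓕 (prodFiltration F) R R') {f : W → ℝ≥0∞}
    (hf : Measurable f) {K : ℝ≥0∞}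
    (hK : ∀ k : W → ℝ≥0∞, Measurable k →
      ∫⁻ w, f w * k w ∂μ ≤ K * mixedENorm d p' Ω P (R' k)) :
    mixedENorm d p Ω P (R f) ≤ K := by
  induction d with
  | zero =>
    by_contra hlt
    have hlt' : K < ∫⁻ y, R f y * 1 ∂Measure.pi P := by
      rw [Measure.pi_of_empty P finZeroElim, lintegral_dirac, mul_one]
      exact not_le.1 hlt
    obtain ⟨k, hk, hk1, hlt'⟩ := h.norming_left (φ := fun _ => 1) hf measurable_const hlt'
    simp only [mul_one] at hlt'
    exact hlt'.not_ge ((hK k hk).trans (mul_le_of_le_one_right' (hk1 _)))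
  | succ d ih =>
    rw [mixedENorm_succ (hp 0).lt]
    refine ih (fun i => hp i.succ) (h.lift (hp 0)) fun k hk => ?_
    rw [← mixedENorm_succ (hp 0).symm.lt]
    exact hK k hk

/-- Doob's maximal inequality for mixed norms, relative to a fibre norm. -/
lemma mixed_maxBound (d : ℕ) (p : Fin d → ℝ≥0∞) (hp : ∀ i, 1 < (p i).toReal) (K : ℝ → ℝ≥0) :
    ∃ C : ℝ≥0, ∀ (Ω : Fin d → Type u) [mΩ : ∀ i, MeasurableSpace (Ω i)]
      (P : ∀ i, Measure (Ω i)) [∀ i, IsProbabilityMeasure (P i)] (F : ∀ i, Filtration ℕ (mΩ i))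
      (W : Type v) (mW : MeasurableSpace W) (μ : Measure W) (𝓕 : Filtration ℕ mW)
      (π : W → ∀ i, Ω i) (R R' : (W → ℝ≥0∞) → (∀ i, Ω i) → ℝ≥0∞), IsFiniteMeasure μ →
      IsFiberNorm π μ (Measure.pi P) 𝓕 (prodFiltration F) R R' →
      (∀ q, 1 < q → MaxBound μ (Measure.pi P) 𝓕 R q (K q)) →
      ∀ (T : Finset ℕ) (f : W → ℝ≥0∞) (e : ℕ → W → ℝ≥0∞), Measurable f →
        (∀ n ∈ T, CondLE (𝓕 n) μ (e n) f) →
        mixedENorm d p Ω P (R fun w => ⨆ n ∈ T, e n w) ≤ C * mixedENorm d p Ω P (R f) := by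
  induction d generalizing K with
  | zero =>
    -- On a one-point space all `L_q` norms coincide; `2` is an arbitrary exponent above `1`.
    refine ⟨K 2, ?_⟩
    intro Ω _ P _ F W mW μ 𝓕 π R R' _ h hM T f e hf he
    have := hM 2 one_lt_two T f e hf he
    simp only [lpn, Measure.pi_of_empty P finZeroElim, lintegral_dirac, ← ENNReal.rpow_mul] at this
    simp only [one_div, ne_eq, OfNat.ofNat_ne_zero, not_false_eq_true, mul_inv_cancel₀,
      ENNReal.rpow_one] at this
    exact this
  | succ d ih =>
    obtain ⟨C, hC⟩ := ih (fun i => p i.succ) (fun i => hp i.succ)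
      fun q => extrapConst' (K (p 0).toReal) (p 0).toReal q
    refine ⟨C, ?_⟩
    intro Ω _ P _ F W mW μ 𝓕 π R R' _ h hM T f e hf he
    have hlift := h.lift (Real.HolderConjugate.conjExponent (hp 0))
    rw [mixedENorm_succ (hp 0), mixedENorm_succ (hp 0)]
    refine hC _ _ _ W mW μ 𝓕 _ _ _ inferInstance hlift (fun q hq => ?_) T f e hf he
    -- Lifting is possible only at outer exponent `p 0`; extrapolation restores all exponents for
    -- the induction hypothesis.
    exact ((hM _ (hp 0)).lift h.left (by linarith [hp 0])).extrapolate_all hlift (hp 0) hq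

/-- **Doob's maximal inequality** for mixed norms. -/
lemma mixed_doob (d : ℕ) (p : Fin d → ℝ≥0∞) (hp : ∀ i, 1 < (p i).toReal) :
    ∃ C : ℝ≥0, ∀ (Ω : Fin d → Type u) [mΩ : ∀ i, MeasurableSpace (Ω i)]
      (P : ∀ i, Measure (Ω i)) [∀ i, IsProbabilityMeasure (P i)] (F : ∀ i, Filtration ℕ (mΩ i))
      (T : Finset ℕ) (f : (∀ i, Ω i) → ℝ≥0∞) (e : ℕ → (∀ i, Ω i) → ℝ≥0∞), Measurable f →
        (∀ n ∈ T, CondLE (prodFiltration F n) (Measure.pi P) (e n) f) →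
        mixedENorm d p Ω P (fun w => ⨆ n ∈ T, e n w) ≤ C * mixedENorm d p Ω P f := by
  obtain ⟨C, hC⟩ := mixed_maxBound d p hp fun q => q.conjExponent.toNNReal
  refine ⟨C, ?_⟩
  intro Ω _ P _ F T f e hf he
  exact hC Ω P F _ _ _ _ id (fun f => f) (fun f => f) inferInstance (isFiberNorm_id _ _)
    (fun q hq => maxBound_id hq) T f e hf he

end Mixed

/-! ### A deterministic bound for `∑ |df| |dh|` by running maxima. -/

section Pathwise

/-- Second order estimate with a weight `b / a` that may be updated by jumps. -/
lemma square_increment_le {x y a b a' b' : ℝ} (hx : |x| ≤ a) (ha' : a' = max a |y|) (hb : 0 ≤ b)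
    (hbb : b ≤ b') :
    (if |y| ≤ 2 * a then b / a * (y - x) ^ 2 / 2 else 0) ≤
      y ^ 2 * (b' / a') / 2 - x ^ 2 * (b / a) / 2 - x * (b / a) * (y - x) + 4 * (b' * (a' - a)) := by
  have hb' : 0 ≤ b' := hb.trans hbb
  have ha0 : 0 ≤ a := (abs_nonneg x).trans hx
  have haa : a ≤ a' := ha' ▸ le_max_left _ _
  have hya : |y| ≤ a' := ha' ▸ le_max_right _ _
  -- When `a = 0` also `x = 0`, and `b / a = 0` by convention.
  rcases ha0.eq_or_lt with h0 | hpos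
  · subst h0
    have : x = 0 := abs_nonpos_iff.1 hx
    have h1 : 0 ≤ y ^ 2 * (b' / a') / 2 := by positivity
    have h2 : 0 ≤ 4 * (b' * a') := by positivity
    split_ifs <;> simp [this] <;> linarith
  have hpos' : 0 < a' := hpos.trans_le haa
  set u := b / a with hu
  have hua : u * a = b := div_mul_cancel₀ b hpos.ne'
  have hu0 : 0 ≤ u := by positivity
  split_ifs with h
  -- Expanding the square about `x` is exact; the only loss is from replacing the weight `b / a` by
  -- `b' / a'`.
  · have key : y ^ 2 * u ≤ y ^ 2 * (b' / a') + 8 * (b' * (a' - a)) := by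
      rcases le_or_gt |y| a with hle | hgt
      · have : a' = a := by rw [ha', max_eq_left hle]
        rw [this, hu, sub_self]
        have : b / a ≤ b' / a := by gcongr
        nlinarith [sq_nonneg y]
      · have hy : a' = |y| := by rw [ha', max_eq_right hgt.le]
        have hy2 : y ^ 2 = a' ^ 2 := by rw [hy, sq_abs]
        have e1 : y ^ 2 * (b' / a') = a' * b' := by rw [hy2]; field_simp
        have e2 : u * a' ≤ 2 * b := by nlinarith
        have e3 : y ^ 2 * u - a' * b = (u * a') * (a' - a) := by rw [hy2, ← hua]; ring
        have e4 : (u * a') * (a' - a) ≤ 2 * b * (a' - a) := by gcongr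
        have e5 : b * (a' - a) ≤ b' * (a' - a) := by gcongr
        have e6 : 0 ≤ b' * (a' - a) := mul_nonneg hb' (by linarith)
        have e7 : a' * b ≤ a' * b' := by gcongr
        rw [e1]
        linarith
    nlinarith
  -- After a large jump `a' ≤ 2 * (a' - a)`, so the growth of the running maximum absorbs every
  -- error.
  · have hgt : 2 * a < |y| := not_le.1 h
    have hy : a' = |y| := by rw [ha', max_eq_right (by linarith)]
    have hy2 : y ^ 2 = a' ^ 2 := by rw [hy, sq_abs]
    have e1 : y ^ 2 * (b' / a') = a' * b' := by rw [hy2]; field_simp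
    have e2 : x * y ≤ a * a' := by
      calc x * y ≤ |x * y| := le_abs_self _
        _ = |x| * |y| := abs_mul _ _
        _ ≤ a * a' := by rw [hy]; gcongr
    have e3 : u * (x * y) ≤ u * (a * a') := by gcongr
    have e4 : b * a' ≤ b' * a' := by gcongr
    have e5 : b' * a' ≤ b' * (2 * (a' - a)) := mul_le_mul_of_nonneg_left (by linarith) hb'
    have e6 : 0 ≤ u * x ^ 2 := by positivity
    have e7 : 0 ≤ a' * b' := by positivity
    rw [e1]
    have e8 : u * (a * a') = b * a' := by rw [← mul_assoc, hua]
    nlinarith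

/-- The potential in the pathwise bilinear estimate. -/
noncomputable def potential (x u a b : ℝ) : ℝ :=
  x ^ 2 * (b / a) / 2 + u ^ 2 * (a / b) / 2 + 24 * (a * b)

lemma potential_nonneg {x u a b : ℝ} (ha : 0 ≤ a) (hb : 0 ≤ b) : 0 ≤ potential x u a b := by
  unfold potential
  positivity

lemma sq_mul_div_le {x a b : ℝ} (hx : |x| ≤ a) (hb : 0 ≤ b) : x ^ 2 * (b / a) ≤ a * b := by
  have ha0 : 0 ≤ a := (abs_nonneg x).trans hx
  rcases ha0.eq_or_lt with h0 | hpos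
  · simp [← h0]
  calc x ^ 2 * (b / a) ≤ a ^ 2 * (b / a) := by
        refine mul_le_mul_of_nonneg_right ?_ (by positivity)
        exact sq_le_sq' (neg_le_of_abs_le hx) (le_of_abs_le hx)
    _ = a * b := by field_simp

lemma potential_le {x u a b : ℝ} (hx : |x| ≤ a) (hu : |u| ≤ b) : potential x u a b ≤ 25 * (a * b) := by
  have h1 := sq_mul_div_le hx ((abs_nonneg u).trans hu)
  have h2 := sq_mul_div_le hu ((abs_nonneg x).trans hx)
  unfold potential
  linarith

/-- One step of the pathwise bilinear estimate. -/
lemma abs_mul_increment_le {x y u v a b a' b' : ℝ} (hx : |x| ≤ a) (hu : |u| ≤ b)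
    (ha' : a' = max a |y|) (hb' : b' = max b |v|) :
    |y - x| * |v - u| ≤ potential y v a' b' - potential x u a b
      - x * (b / a) * (y - x) - u * (a / b) * (v - u) := by
  have ha0 : 0 ≤ a := (abs_nonneg x).trans hx
  have hb0 : 0 ≤ b := (abs_nonneg u).trans hu
  have haa : a ≤ a' := ha' ▸ le_max_left _ _
  have hbb : b ≤ b' := hb' ▸ le_max_left _ _
  have hya : |y| ≤ a' := ha' ▸ le_max_right _ _
  have hvb : |v| ≤ b' := hb' ▸ le_max_right _ _
  have h1 := square_increment_le hx ha' hb0 hbb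
  have h2 := square_increment_le hu hb' ha0 haa
  have n1 : 0 ≤ b' * (a' - a) := mul_nonneg (hb0.trans hbb) (by linarith)
  have n2 : 0 ≤ a' * (b' - b) := mul_nonneg (ha0.trans haa) (by linarith)
  -- The errors have coefficient `4` from the squares and `8` from large jumps; the factor `2` here
  -- gives the `24` in `potential`.
  have hsum : b' * (a' - a) + a' * (b' - b) ≤ 2 * (a' * b' - a * b) := by nlinarith
  have hdx : |y - x| ≤ |y| + |x| := abs_sub _ _
  have hdu : |v - u| ≤ |v| + |u| := abs_sub _ _
  have t1 : 0 ≤ if |y| ≤ 2 * a then b / a * (y - x) ^ 2 / 2 else 0 := by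
    split_ifs <;> positivity
  have t2 : 0 ≤ if |v| ≤ 2 * b then a / b * (v - u) ^ 2 / 2 else 0 := by
    split_ifs <;> positivity
  suffices |y - x| * |v - u| ≤ (if |y| ≤ 2 * a then b / a * (y - x) ^ 2 / 2 else 0)
      + (if |v| ≤ 2 * b then a / b * (v - u) ^ 2 / 2 else 0)
      + 8 * (b' * (a' - a)) + 8 * (a' * (b' - b)) by
    unfold potential
    linarith
  -- Two small jumps: weighted AM-GM. Otherwise a large jump is at most four times the growth of its
  -- running maximum.
  by_cases hy : |y| ≤ 2 * a
  · by_cases hv : |v| ≤ 2 * b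
    · rw [if_pos hy, if_pos hv]
      have : |y - x| * |v - u| ≤ b / a * (y - x) ^ 2 / 2 + a / b * (v - u) ^ 2 / 2 := by
        rcases ha0.eq_or_lt with h0 | hapos
        · have e1 : x = 0 := abs_nonpos_iff.1 (by linarith)
          have e2 : y = 0 := abs_nonpos_iff.1 (by linarith)
          simp [e1, e2, ← h0]
        rcases hb0.eq_or_lt with h0 | hbpos
        · have e1 : u = 0 := abs_nonpos_iff.1 (by linarith)
          have e2 : v = 0 := abs_nonpos_iff.1 (by linarith)
          simp [e1, e2, ← h0]
        rw [← sq_abs (y - x), ← sq_abs (v - u)]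
        set s := |y - x|
        set t := |v - u|
        have e : b / a * s ^ 2 / 2 + a / b * t ^ 2 / 2 - s * t = (b * s - a * t) ^ 2 / (2 * a * b) := by
          field_simp
          ring
        have : 0 ≤ (b * s - a * t) ^ 2 / (2 * a * b) := by positivity
        linarith
      linarith
    · have h3 : |v - u| ≤ 4 * (b' - b) := by linarith
      have h4 : |y - x| ≤ 2 * a' := by linarith
      have : |y - x| * |v - u| ≤ (2 * a') * (4 * (b' - b)) :=
        mul_le_mul h4 h3 (abs_nonneg _) (by linarith)
      linarith
  · have h3 : |y - x| ≤ 4 * (a' - a) := by linarith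
    have h4 : |v - u| ≤ 2 * b' := by linarith
    have : |y - x| * |v - u| ≤ (4 * (a' - a)) * (2 * b') :=
      mul_le_mul h3 h4 (abs_nonneg _) (by linarith)
    linarith

/-- The running maximum of the absolute values of a sequence. -/
def runningMax (f : ℕ → ℝ) : ℕ → ℝ
  | 0 => |f 0|
  | n + 1 => max (runningMax f n) |f (n + 1)|

lemma abs_le_runningMax (f : ℕ → ℝ) (n : ℕ) : |f n| ≤ runningMax f n := by
  cases n with
  | zero => exact le_rfl
  | succ n => exact le_max_right _ _

lemma runningMax_nonneg (f : ℕ → ℝ) (n : ℕ) : 0 ≤ runningMax f n :=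
  (abs_nonneg _).trans (abs_le_runningMax f n)

lemma enorm_runningMax_le (f : ℕ → ℝ) (n : ℕ) :
    ‖runningMax f n‖ₑ ≤ ⨆ k ∈ Finset.range (n + 1), ‖f k‖ₑ := by
  induction n with
  | zero => simp [runningMax]
  | succ n ih =>
    rw [runningMax]
    rcases max_choice (runningMax f n) |f (n + 1)| with h | h
    · rw [h]
      exact ih.trans (biSup_mono fun k hk => Finset.range_mono (Nat.le_succ _) hk)
    · rw [h, ← Real.norm_eq_abs, enorm_norm]
      exact le_iSup₂ (f := fun k (_ : k ∈ Finset.range (n + 1 + 1)) => ‖f k‖ₑ) (n + 1)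
        (Finset.self_mem_range_succ _)

lemma runningMax_le {f : ℕ → ℝ} {c : ℝ} (h : ∀ n, |f n| ≤ c) (n : ℕ) : runningMax f n ≤ c := by
  induction n with
  | zero => exact h 0
  | succ n ih => exact max_le ih (h _)

/-- The pathwise bilinear estimate. -/
lemma sum_abs_mul_increment_le (f h : ℕ → ℝ) (N : ℕ) :
    ∑ n ∈ Finset.range N, |f (n + 1) - f n| * |h (n + 1) - h n| ≤
      25 * (runningMax f N * runningMax h N)
      - ∑ n ∈ Finset.range N, f n * (runningMax h n / runningMax f n) * (f (n + 1) - f n)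
      - ∑ n ∈ Finset.range N, h n * (runningMax f n / runningMax h n) * (h (n + 1) - h n) := by
  set V : ℕ → ℝ := fun n => potential (f n) (h n) (runningMax f n) (runningMax h n) with hV
  have hstep := Finset.sum_le_sum fun n (_ : n ∈ Finset.range N) =>
    abs_mul_increment_le (abs_le_runningMax f n) (abs_le_runningMax h n)
      (a' := runningMax f (n + 1)) (b' := runningMax h (n + 1)) (y := f (n + 1))
      (v := h (n + 1)) rfl rfl
  rw [Finset.sum_sub_distrib, Finset.sum_sub_distrib, Finset.sum_range_sub V] at hstep
  have h0 : 0 ≤ V 0 := potential_nonneg (runningMax_nonneg f 0) (runningMax_nonneg h 0)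
  have hN : V N ≤ _ := potential_le (abs_le_runningMax f N) (abs_le_runningMax h N)
  linarith

end Pathwise

/-! ### From the pathwise estimate to pairings with martingale transforms. -/

section Bilinear

variable {X : Type*} {mX : MeasurableSpace X} {μ : Measure X} {𝓕 : Filtration ℕ mX}
  {f h : ℕ → X → ℝ}

lemma condExp_mul_increment_eq_zero [IsFiniteMeasure μ] (hf : Martingale f 𝓕 μ) {G : X → ℝ} {n : ℕ}
    (hG : StronglyMeasurable[𝓕 n] G)
    (hi : Integrable (fun x => G x * (f (n + 1) x - f n x)) μ) :
    μ[fun x => G x * (f (n + 1) x - f n x) | 𝓕 n] =ᵐ[μ] 0 := by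
  have h1 := condExp_mul_of_stronglyMeasurable_left (μ := μ) (g := f (n + 1) - f n) hG hi
    ((hf.integrable _).sub (hf.integrable _))
  have h2 := condExp_sub (hf.integrable (n + 1)) (hf.integrable n) (𝓕 n)
  have h3 := hf.2 n (n + 1) n.le_succ
  have h4 := hf.2 n n le_rfl
  filter_upwards [h1, h2, h3, h4] with x e1 e2 e3 e4
  refine e1.trans ?_
  simp only [Pi.mul_apply, Pi.sub_apply, Pi.zero_apply] at e2 ⊢
  rw [e2, e3, e4, sub_self, mul_zero]

lemma integral_mul_increment_eq_zero [IsFiniteMeasure μ] (hf : Martingale f 𝓕 μ) {G : X → ℝ}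
    {n : ℕ} (hG : StronglyMeasurable[𝓕 n] G)
    (hi : Integrable (fun x => G x * (f (n + 1) x - f n x)) μ) :
    ∫ x, G x * (f (n + 1) x - f n x) ∂μ = 0 := by
  rw [← integral_condExp (𝓕.le n), integral_congr_ae (condExp_mul_increment_eq_zero hf hG hi)]
  simp

lemma measurable_runningMax (hf : ∀ n, Measurable[𝓕 n] (f n)) (n : ℕ) :
    Measurable[𝓕 n] fun x => runningMax (fun k => f k x) n := by
  induction n with
  | zero => exact measurable_norm.comp (hf 0)
  | succ n ih =>
    exact (ih.mono (𝓕.mono n.le_succ) le_rfl).max (measurable_norm.comp (hf (n + 1)))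

lemma integrable_runningMax (hf : ∀ n, Integrable (f n) μ) (n : ℕ) :
    Integrable (fun x => runningMax (fun k => f k x) n) μ := by
  induction n with
  | zero => exact (hf 0).abs
  | succ n ih => exact ih.sup (hf (n + 1)).abs

/-- The bilinear estimate for the increments of two martingales, one of them bounded. -/
lemma sum_integral_abs_increments_le [IsFiniteMeasure μ] (hf : Martingale f 𝓕 μ)
    (hh : Martingale h 𝓕 μ) {c : ℝ} (hc : ∀ n, ∀ᵐ x ∂μ, |h n x| ≤ c) (N : ℕ) :
    Integrable (fun x => runningMax (fun k => f k x) N * runningMax (fun k => h k x) N) μ ∧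
    ∑ n ∈ Finset.range N, ∫ x, |f (n + 1) x - f n x| * |h (n + 1) x - h n x| ∂μ ≤
      25 * ∫ x, runningMax (fun k => f k x) N * runningMax (fun k => h k x) N ∂μ := by
  have hc' : ∀ᵐ x ∂μ, ∀ n, |h n x| ≤ c := ae_all_iff.2 hc
  have hfm : ∀ n, Measurable[𝓕 n] (f n) := fun n => (hf.1 n).measurable
  have hhm : ∀ n, Measurable[𝓕 n] (h n) := fun n => (hh.1 n).measurable
  have hfi := hf.integrable
  have hhi := hh.integrable
  have hAm := measurable_runningMax hfm
  have hBm := measurable_runningMax hhm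
  have hAi := integrable_runningMax hfi
  have hBi := integrable_runningMax hhi
  have hBc : ∀ n, ∀ᵐ x ∂μ, ‖runningMax (fun k => h k x) n‖ ≤ c := fun n => by
    filter_upwards [hc'] with x hx
    rw [Real.norm_of_nonneg (runningMax_nonneg _ _)]
    exact runningMax_le hx n
  have hdc : ∀ n, ∀ᵐ x ∂μ, ‖h (n + 1) x - h n x‖ ≤ c + c := fun n => by
    filter_upwards [hc'] with x hx
    exact (norm_sub_le _ _).trans (add_le_add (hx _) (hx _))
  have hdi : ∀ n, Integrable (fun x => h (n + 1) x - h n x) μ := fun n => (hhi _).sub (hhi _)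
  have hfdi : ∀ n, Integrable (fun x => f (n + 1) x - f n x) μ := fun n => (hfi _).sub (hfi _)
  have hAB : Integrable
      (fun x => runningMax (fun k => f k x) N * runningMax (fun k => h k x) N) μ :=
    (hAi N).mul_bdd (hBi N).aestronglyMeasurable (hBc N)
  have hprod : ∀ n, Integrable (fun x => |f (n + 1) x - f n x| * |h (n + 1) x - h n x|) μ := by
    intro n
    refine (hfdi n).abs.mul_bdd (c := c + c) (hdi n).abs.aestronglyMeasurable ?_
    filter_upwards [hdc n] with x hx
    simpa using hx
  set G : ℕ → X → ℝ := fun n x =>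
    f n x * (runningMax (fun k => h k x) n / runningMax (fun k => f k x) n)
  set H : ℕ → X → ℝ := fun n x =>
    h n x * (runningMax (fun k => f k x) n / runningMax (fun k => h k x) n)
  -- This bounds `G n` by `c` and `H n` by the running maximum of `f`, making the mean-zero terms
  -- integrable.
  have hratio : ∀ {x a b : ℝ}, |x| ≤ a → 0 ≤ b → |x * (b / a)| ≤ b := by
    intro x a b hx hb
    have ha : 0 ≤ a := (abs_nonneg x).trans hx
    rw [abs_mul, abs_of_nonneg (div_nonneg hb ha)]
    rcases ha.eq_or_lt with h0 | h0
    · simp [← h0, hb]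
    · calc |x| * (b / a) ≤ a * (b / a) := by gcongr
        _ = b := by field_simp
  have hGm : ∀ n, Measurable[𝓕 n] (G n) := fun n => (hfm n).mul ((hBm n).div (hAm n))
  have hHm : ∀ n, Measurable[𝓕 n] (H n) := fun n => (hhm n).mul ((hAm n).div (hBm n))
  have hGi : ∀ n, Integrable (fun x => G n x * (f (n + 1) x - f n x)) μ := fun n => by
    refine (hfdi n).bdd_mul (c := c)
      ((hGm n).mono (𝓕.le n) le_rfl).aestronglyMeasurable ?_
    filter_upwards [hBc n] with x hx
    rw [Real.norm_of_nonneg (runningMax_nonneg _ _)] at hx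
    exact (hratio (abs_le_runningMax (fun k => f k x) n) (runningMax_nonneg _ _)).trans hx
  have hHi : ∀ n, Integrable (fun x => H n x * (h (n + 1) x - h n x)) μ := fun n => by
    refine Integrable.mul_bdd (c := c + c) ?_ (hdi n).aestronglyMeasurable (hdc n)
    refine (hAi n).mono ((hHm n).mono (𝓕.le n) le_rfl).aestronglyMeasurable (ae_of_all _ fun x => ?_)
    rw [Real.norm_of_nonneg (runningMax_nonneg _ _)]
    exact hratio (abs_le_runningMax (fun k => h k x) n) (runningMax_nonneg _ _)
  refine ⟨hAB, ?_⟩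
  have key := integral_mono (μ := μ)
    (f := fun x => ∑ n ∈ Finset.range N, |f (n + 1) x - f n x| * |h (n + 1) x - h n x|)
    (g := fun x => 25 * (runningMax (fun k => f k x) N * runningMax (fun k => h k x) N)
      - ∑ n ∈ Finset.range N, G n x * (f (n + 1) x - f n x)
      - ∑ n ∈ Finset.range N, H n x * (h (n + 1) x - h n x))
    (integrable_finsetSum _ fun n _ => hprod n)
    (((hAB.const_mul 25).sub (integrable_finsetSum _ fun n _ => hGi n)).sub
      (integrable_finsetSum _ fun n _ => hHi n))
    (fun x => sum_abs_mul_increment_le (fun k => f k x) (fun k => h k x) N)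
  rw [integral_finsetSum _ fun n _ => hprod n, integral_sub, integral_sub,
    integral_finsetSum _ fun n _ => hGi n, integral_finsetSum _ fun n _ => hHi n,
    integral_const_mul,
    Finset.sum_eq_zero fun n _ => integral_mul_increment_eq_zero hf (hGm n).stronglyMeasurable
      (hGi n),
    Finset.sum_eq_zero fun n _ => integral_mul_increment_eq_zero hh (hHm n).stronglyMeasurable
      (hHi n)] at key
  · simpa using key
  · exact hAB.const_mul 25
  · exact integrable_finsetSum _ fun n _ => hGi n
  · exact (hAB.const_mul 25).sub (integrable_finsetSum _ fun n _ => hGi n)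
  · exact integrable_finsetSum _ fun n _ => hHi n

variable {b : ℕ → X → ℝ}

lemma integrable_transform_increment (hf : ∀ n, Integrable (f n) μ)
    (hb : ∀ k, Measurable[𝓕 k] (b k)) (hb1 : ∀ k, ∀ᵐ x ∂μ, |b k x| ≤ 1) (n : ℕ) :
    Integrable (fun x => b n x * (f (n + 1) x - f n x)) μ :=
  ((hf (n + 1)).sub (hf n)).bdd_mul (c := 1)
    ((hb n).mono (𝓕.le n) le_rfl).aestronglyMeasurable (hb1 n)

/-- Martingale transforms are martingales. -/
lemma martingale_transform [IsFiniteMeasure μ] (hf : Martingale f 𝓕 μ)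
    (hb : ∀ k, Measurable[𝓕 k] (b k)) (hb1 : ∀ k, ∀ᵐ x ∂μ, |b k x| ≤ 1) :
    Martingale (transform b f) 𝓕 μ := by
  have hi := integrable_transform_increment (𝓕 := 𝓕) hf.integrable hb hb1
  refine martingale_of_condExp_sub_eq_zero_nat (fun n => ?_) (fun n => ?_) fun n => ?_
  · refine Measurable.stronglyMeasurable (Finset.measurable_fun_sum _ fun k hk => ?_)
    have hk := Finset.mem_range.1 hk
    have h1 := (hf.1 (k + 1)).measurable.mono (𝓕.mono hk) le_rfl
    have h2 := (hf.1 k).measurable.mono (𝓕.mono hk.le) le_rfl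
    exact ((hb k).mono (𝓕.mono hk.le) le_rfl).mul (h1.sub h2)
  · exact integrable_finsetSum _ fun k _ => hi k
  · have : transform b f (n + 1) - transform b f n = fun x => b n x * (f (n + 1) x - f n x) := by
      ext x
      simp [transform, Finset.sum_range_succ]
    rw [this]
    exact condExp_mul_increment_eq_zero hf (hb n).stronglyMeasurable (hi n)

/-- The pairing of a martingale transform with a bounded function. -/
lemma integral_transform_mul_le [IsFiniteMeasure μ] (hf : Martingale f 𝓕 μ)
    (hb : ∀ k, Measurable[𝓕 k] (b k)) (hb1 : ∀ k, ∀ᵐ x ∂μ, |b k x| ≤ 1) {Φ : X → ℝ} {c : ℝ}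
    (hΦ : Measurable Φ) (hΦc : ∀ x, |Φ x| ≤ c) (N : ℕ) :
    Integrable (fun x => runningMax (fun k => f k x) N * runningMax (fun k => μ[Φ | 𝓕 k] x) N) μ ∧
    ∫ x, transform b f N x * Φ x ∂μ ≤
      25 * ∫ x, runningMax (fun k => f k x) N * runningMax (fun k => μ[Φ | 𝓕 k] x) N ∂μ := by
  have hΦi : Integrable Φ μ := Integrable.of_bound hΦ.aestronglyMeasurable c (ae_of_all _ hΦc)
  set h : ℕ → X → ℝ := fun n => μ[Φ | 𝓕 n] with hh
  have hM : Martingale h 𝓕 μ := martingale_condExp Φ 𝓕 μ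
  have hc : ∀ n, ∀ᵐ x ∂μ, |h n x| ≤ c := fun n =>
    ae_bdd_abs_condExp_of_ae_bdd_abs (ae_of_all _ hΦc)
  obtain ⟨hint, hle⟩ := sum_integral_abs_increments_le hf hM hc N
  refine ⟨hint, le_trans ?_ hle⟩
  have hi := integrable_transform_increment (𝓕 := 𝓕) hf.integrable hb hb1
  have hhm : ∀ n, AEStronglyMeasurable (h n) μ := fun n => (hM.integrable n).aestronglyMeasurable
  have hiΦ : ∀ n, Integrable (fun x => b n x * (f (n + 1) x - f n x) * Φ x) μ := fun n =>
    (hi n).mul_bdd hΦ.aestronglyMeasurable (ae_of_all _ hΦc)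
  have hih : ∀ n m, Integrable (fun x => b n x * (f (n + 1) x - f n x) * h m x) μ := fun n m =>
    (hi n).mul_bdd (hhm m) (hc m)
  simp only [transform, Finset.sum_mul]
  rw [integral_finsetSum _ fun n _ => hiΦ n]
  refine Finset.sum_le_sum fun n _ => ?_
  -- `Φ` is first conditioned on time `n + 1`; the part at time `n` then integrates to zero, leaving
  -- the increment of `h`.
  have e1 : ∫ x, b n x * (f (n + 1) x - f n x) * Φ x ∂μ
      = ∫ x, b n x * (f (n + 1) x - f n x) * h (n + 1) x ∂μ := by
    rw [← integral_condExp (𝓕.le (n + 1))]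
    refine integral_congr_ae (condExp_mul_of_stronglyMeasurable_left (g := Φ)
      (f := fun x => b n x * (f (n + 1) x - f n x)) ?_ (hiΦ n) hΦi)
    refine Measurable.stronglyMeasurable ?_
    exact ((hb n).mono (𝓕.mono n.le_succ) le_rfl).mul ((hf.1 (n + 1)).measurable.sub
      ((hf.1 n).measurable.mono (𝓕.mono n.le_succ) le_rfl))
  have e2 : ∫ x, b n x * (f (n + 1) x - f n x) * h n x ∂μ = 0 := by
    have hm : StronglyMeasurable[𝓕 n] fun x => b n x * h n x :=
      ((hb n).mul (hM.1 n).measurable).stronglyMeasurable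
    rw [← integral_mul_increment_eq_zero hf hm]
    · congr 1 with x
      ring
    · convert! hih n n using 2 with x
      ring
  have e3 : ∫ x, b n x * (f (n + 1) x - f n x) * Φ x ∂μ
      = ∫ x, b n x * (f (n + 1) x - f n x) * (h (n + 1) x - h n x) ∂μ := by
    simp only [mul_sub (b n _ * (f (n + 1) _ - f n _)) (h _ _)]
    rw [integral_sub (hih n (n + 1)) (hih n n), e2, sub_zero, e1]
  rw [e3]
  refine integral_mono_ae ?_ ?_ ?_
  · convert! (hih n (n + 1)).sub (hih n n) using 2 with x
    simp only [Pi.sub_apply]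
    ring
  · refine ((hf.integrable (n + 1)).sub (hf.integrable n)).abs.mul_bdd (c := c + c)
      ((hhm (n + 1)).sub (hhm n)).norm ?_
    filter_upwards [hc n, hc (n + 1)] with x h1 h2
    change ‖‖h (n + 1) x - h n x‖‖ ≤ c + c
    rw [norm_norm]
    exact (norm_sub_le _ _).trans (add_le_add h2 h1)
  · filter_upwards [hb1 n] with x hx
    refine (le_abs_self _).trans ?_
    rw [abs_mul, abs_mul]
    gcongr
    exact mul_le_of_le_one_left (abs_nonneg _) hx

/-- The `L_1` contraction of conditional expectation, applied to `g` cut off to each event of `m`.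
-/
lemma condLE_enorm_of_ae_eq_condExp {m : MeasurableSpace X} (hm : m ≤ mX) {e g : X → ℝ}
    (he : StronglyMeasurable[m] e) (hg : Integrable g μ) (h : e =ᵐ[μ] μ[g | m]) :
    CondLE m μ (fun x => ‖e x‖ₑ) (fun x => ‖g x‖ₑ) := by
  refine ⟨he.enorm, fun s hs => ?_⟩
  have h1 : s.indicator e =ᵐ[μ] μ[s.indicator g | m] := by
    filter_upwards [h, condExp_indicator hg hs] with x e1 e2
    rw [e2]
    by_cases hx : x ∈ s <;> simp [hx, e1]
  have h2 := (eLpNorm_congr_ae h1).trans_le (eLpNorm_condExp_le_eLpNorm (s.indicator g) le_rfl)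
  rw [eLpNorm_one_eq_lintegral_enorm, eLpNorm_one_eq_lintegral_enorm] at h2
  rw [← lintegral_indicator (hm s hs), ← lintegral_indicator (hm s hs)]
  simpa only [enorm_indicator_eq_indicator_enorm] using h2

/-- The pairing of a martingale transform with a bounded nonnegative function is controlled by the
maximal functions of two martingales. -/
lemma exists_lintegral_transform_mul_le [IsFiniteMeasure μ] (hf : Martingale f 𝓕 μ)
    (hb : ∀ k, Measurable[𝓕 k] (b k)) (hb1 : ∀ k, ∀ᵐ x ∂μ, |b k x| ≤ 1) {k : X → ℝ≥0∞} {c : ℝ≥0}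
    (hk : Measurable k) (hkc : ∀ x, k x ≤ c) (N : ℕ) :
    ∃ h : ℕ → X → ℝ, (∀ n, CondLE (𝓕 n) μ (fun x => ‖h n x‖ₑ) k) ∧
      ∫⁻ x, ‖transform b f N x‖ₑ * k x ∂μ ≤ 25 * ∫⁻ x,
        (⨆ n ∈ Finset.range (N + 1), ‖f n x‖ₑ) * ⨆ n ∈ Finset.range (N + 1), ‖h n x‖ₑ ∂μ := by
  have hkfin : ∀ x, k x ≠ ∞ := fun x => ((hkc x).trans_lt ENNReal.coe_lt_top).ne
  have hT := (martingale_transform hf hb hb1)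
  have hTm : Measurable (transform b f N) := ((hT.1 N).measurable).mono (𝓕.le N) le_rfl
  -- `k` times the sign of the transform, so that the pairing equals the integral of `|𝒯f| k`.
  set Φ : X → ℝ := fun x => if 0 ≤ transform b f N x then (k x).toReal else -(k x).toReal
  have hΦm : Measurable Φ := Measurable.ite (measurableSet_le measurable_const hTm)
    hk.ennreal_toReal hk.ennreal_toReal.neg
  have hΦabs : ∀ x, |Φ x| = (k x).toReal := fun x => by
    simp only [Φ]
    split_ifs <;> simp
  have hΦc : ∀ x, |Φ x| ≤ c := fun x => by
    rw [hΦabs]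
    exact ENNReal.toReal_le_coe_of_le_coe (hkc x)
  have hΦe : ∀ x, ‖Φ x‖ₑ = k x := fun x => by
    rw [← enorm_norm, Real.norm_eq_abs, hΦabs, Real.enorm_of_nonneg ENNReal.toReal_nonneg,
      ENNReal.ofReal_toReal (hkfin x)]
  have hΦT : ∀ x, transform b f N x * Φ x = ‖transform b f N x * Φ x‖ := fun x => by
    rw [norm_mul, Real.norm_eq_abs (Φ x), hΦabs, Real.norm_eq_abs]
    simp only [Φ]
    split_ifs with h
    · rw [abs_of_nonneg h]
    · rw [abs_of_neg (not_le.1 h)]; ring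
  have hΦi : Integrable Φ μ := Integrable.of_bound hΦm.aestronglyMeasurable c (ae_of_all _ hΦc)
  obtain ⟨hint, hle⟩ := integral_transform_mul_le hf hb hb1 hΦm hΦc N
  refine ⟨fun n => μ[Φ | 𝓕 n], fun n => ?_, ?_⟩
  · simpa only [hΦe] using condLE_enorm_of_ae_eq_condExp (𝓕.le n) stronglyMeasurable_condExp hΦi
      EventuallyEq.rfl
  calc ∫⁻ x, ‖transform b f N x‖ₑ * k x ∂μ
      = ENNReal.ofReal (∫ x, transform b f N x * Φ x ∂μ) := by
        rw [integral_congr_ae (ae_of_all _ hΦT), ofReal_integral_norm_eq_lintegral_enorm]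
        · simp only [enorm_mul, hΦe]
        · exact (hT.integrable N).mul_bdd hΦm.aestronglyMeasurable (ae_of_all _ hΦc)
    _ ≤ 25 * ENNReal.ofReal (∫ x, runningMax (fun k => f k x) N
          * runningMax (fun k => μ[Φ | 𝓕 k] x) N ∂μ) := by
        refine (ENNReal.ofReal_le_ofReal hle).trans_eq ?_
        rw [ENNReal.ofReal_mul (by norm_num)]
        norm_num
    _ = 25 * ∫⁻ x, ‖runningMax (fun k => f k x) N
          * runningMax (fun k => μ[Φ | 𝓕 k] x) N‖ₑ ∂μ := by
        rw [← ofReal_integral_norm_eq_lintegral_enorm hint]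
        congr 3 with x
        exact (Real.norm_of_nonneg
          (mul_nonneg (runningMax_nonneg _ _) (runningMax_nonneg _ _))).symm
    _ ≤ _ := by
        gcongr with x
        rw [enorm_mul]
        exact mul_le_mul' (enorm_runningMax_le _ _) (enorm_runningMax_le _ _)

end Bilinear

/-! ### Martingale transforms in mixed norm. -/

section Transform

universe u

variable {d : ℕ} {Ω : Fin d → Type u} [mΩ : ∀ i, MeasurableSpace (Ω i)] {P : ∀ i, Measure (Ω i)}

lemma mixedENorm_mono {d : ℕ} {p : Fin d → ℝ≥0∞} {Ω : Fin d → Type u}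
    [mΩ : ∀ i, MeasurableSpace (Ω i)] {P : ∀ i, Measure (Ω i)} {f g : (∀ i, Ω i) → ℝ≥0∞}
    (h : ∀ x, f x ≤ g x) : mixedENorm d p Ω P f ≤ mixedENorm d p Ω P g := by
  induction d with
  | zero => exact h _
  | succ d ih => exact ih fun y => eLpNorm_mono_enorm fun x => h _

/-- Pairing with the constant `1` then yields the `L_1` bound needed for convergence. -/
lemma mixedENorm_one {d : ℕ} {p : Fin d → ℝ≥0∞} (hp : ∀ i, p i ≠ 0) {Ω : Fin d → Type u}
    [mΩ : ∀ i, MeasurableSpace (Ω i)] {P : ∀ i, Measure (Ω i)}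
    [∀ i, IsProbabilityMeasure (P i)] : mixedENorm d p Ω P (fun _ => 1) = 1 := by
  induction d with
  | zero => rfl
  | succ d ih =>
    rw [mixedENorm]
    simp only [eLpNorm_const _ (hp 0) (IsProbabilityMeasure.ne_zero (P 0)), measure_univ,
      ENNReal.one_rpow, mul_one]
    exact ih fun i => hp i.succ

/-- A bound for the mixed norm from bounds for pairings. -/
lemma mixedNorm_le_of_forall_pairing [∀ i, IsProbabilityMeasure (P i)] {p p' : Fin d → ℝ≥0∞}
    (hp : ∀ i, (p i).toReal.HolderConjugate (p' i).toReal) (F : ∀ i, Filtration ℕ (mΩ i))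
    {f : (∀ i, Ω i) → ℝ} (hf : Measurable f) {K : ℝ≥0∞}
    (hK : ∀ k : (∀ i, Ω i) → ℝ≥0∞, Measurable k →
      ∫⁻ w, ‖f w‖ₑ * k w ∂Measure.pi P ≤ K * mixedENorm d p' Ω P k) :
    mixedNorm p P f ≤ K :=
  mixed_norming d hp (isFiberNorm_id (Measure.pi P) (prodFiltration F)) hf.enorm hK

/-- Martingale transforms in mixed norm, in dual form. -/
lemma lintegral_transform_mul_le [∀ i, IsProbabilityMeasure (P i)] {p p' : Fin d → ℝ≥0∞}
    (hp : ∀ i, (p i).toReal.HolderConjugate (p' i).toReal) {F : ∀ i, Filtration ℕ (mΩ i)}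
    {C C' : ℝ≥0}
    (hC : ∀ (T : Finset ℕ) (f : (∀ i, Ω i) → ℝ≥0∞) (e : ℕ → (∀ i, Ω i) → ℝ≥0∞), Measurable f →
        (∀ n ∈ T, CondLE (prodFiltration F n) (Measure.pi P) (e n) f) →
        mixedENorm d p Ω P (fun w => ⨆ n ∈ T, e n w) ≤ C * mixedENorm d p Ω P f)
    (hC' : ∀ (T : Finset ℕ) (f : (∀ i, Ω i) → ℝ≥0∞) (e : ℕ → (∀ i, Ω i) → ℝ≥0∞), Measurable f →
        (∀ n ∈ T, CondLE (prodFiltration F n) (Measure.pi P) (e n) f) →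
        mixedENorm d p' Ω P (fun w => ⨆ n ∈ T, e n w) ≤ C' * mixedENorm d p' Ω P f)
    {b f : ℕ → (∀ i, Ω i) → ℝ} (hb : ∀ k, Measurable[prodFiltration F k] (b k))
    (hb1 : ∀ k, ∀ᵐ x ∂Measure.pi P, |b k x| ≤ 1)
    (hf : Martingale f (prodFiltration F) (Measure.pi P)) (N : ℕ) {k : (∀ i, Ω i) → ℝ≥0∞}
    (hk : Measurable k) :
    ∫⁻ x, ‖transform b f N x‖ₑ * k x ∂Measure.pi P
      ≤ (25 * C * C' : ℝ≥0) * mixedNorm p P (f N) * mixedENorm d p' Ω P k := by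
  have hT := martingale_transform hf hb hb1
  have hTm : Measurable fun x => ‖transform b f N x‖ₑ :=
    (((hT.1 N).measurable).mono ((prodFiltration F).le N) le_rfl).enorm
  have hfm : ∀ n, Measurable fun x => ‖f n x‖ₑ := fun n =>
    (((hf.1 n).measurable).mono ((prodFiltration F).le n) le_rfl).enorm
  -- The bilinear estimate needs a bounded test function; monotone convergence removes the
  -- truncation.
  have hsup : ∫⁻ x, ‖transform b f N x‖ₑ * k x ∂Measure.pi P
      = ⨆ j : ℕ, ∫⁻ x, ‖transform b f N x‖ₑ * min (k x) j ∂Measure.pi P := by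
    rw [← lintegral_iSup]
    · simp only [← ENNReal.mul_iSup, iSup_min_natCast]
    · exact fun j => hTm.mul (hk.min measurable_const)
    · intro i j hij x
      dsimp only
      gcongr
  rw [hsup]
  refine iSup_le fun j => ?_
  obtain ⟨h, hh, hle⟩ := exists_lintegral_transform_mul_le hf hb hb1 (k := fun x => min (k x) j)
    (c := j) (hk.min measurable_const) (fun x => min_le_right _ _) N
  have hhm : ∀ n, Measurable fun x => ‖h n x‖ₑ := fun n =>
    (hh n).measurable ((prodFiltration F).le n)
  refine hle.trans ?_
  have h1 := mixed_holder d hp (isFiberNorm_id (Measure.pi P) (prodFiltration F))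
    (measurable_biSup_finset (T := Finset.range (N + 1)) fun n _ => hfm n)
    (measurable_biSup_finset (T := Finset.range (N + 1)) fun n _ => hhm n)
  have h2 := hC (Finset.range (N + 1)) (fun x => ‖f N x‖ₑ) (fun n x => ‖f n x‖ₑ) (hfm N)
    fun n hn => condLE_enorm_of_ae_eq_condExp ((prodFiltration F).le n) (hf.1 n) (hf.integrable N)
      (hf.2 n N (Nat.lt_succ_iff.1 (Finset.mem_range.1 hn))).symm
  have h3 := hC' (Finset.range (N + 1)) _ (fun n x => ‖h n x‖ₑ) (hk.min measurable_const)
    fun n _ => hh n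
  have h4 : mixedENorm d p' Ω P (fun x => min (k x) j) ≤ mixedENorm d p' Ω P k :=
    mixedENorm_mono fun x => min_le_left _ _
  calc _ ≤ 25 * ((C * mixedNorm p P (f N)) * (C' * mixedENorm d p' Ω P k)) := by
        gcongr
        refine h1.trans (mul_le_mul' h2 (h3.trans ?_))
        gcongr
    _ = _ := by
        push_cast
        ring

end Transform

end MixedMartingale

/-! ### The main theorem. -/

open MixedMartingale in
theorem theorem12 (d : ℕ) (hd : 1 ≤ d) (p : Fin d → ℝ≥0∞) (hp : ∀ i, 1 < p i ∧ p i < ∞) :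
    ∃ C : ℝ≥0, ∀ (Ω : Fin d → Type*) [mΩ : ∀ i, MeasurableSpace (Ω i)]
      (P : ∀ i, Measure (Ω i)) [∀ i, IsProbabilityMeasure (P i)]
      (F : ∀ i, Filtration ℕ (mΩ i))
      (b : ℕ → (∀ i, Ω i) → ℝ),
      (∀ k, Measurable[MixedMartingale.prodFiltration F k] (b k)) →
      (∀ k, ∀ᵐ x ∂(Measure.pi P), |b k x| ≤ 1) →
      ∀ f : ℕ → (∀ i, Ω i) → ℝ, MixedMartingale.IsLpBoundedMartingale p P F f →
        MixedMartingale.IsLpBoundedMartingale p P F (MixedMartingale.transform b f) ∧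
        MixedMartingale.seqNorm p P (MixedMartingale.transform b f) ≤
          C * MixedMartingale.seqNorm p P f ∧
        ∃ g : (∀ i, Ω i) → ℝ, Measurable g ∧
          (∀ᵐ x ∂(Measure.pi P), Tendsto (fun n => MixedMartingale.transform b f n x)
            atTop (𝓝 (g x))) ∧
          MixedMartingale.mixedNorm p P g ≤ C * MixedMartingale.seqNorm p P f := by
  have hp1 : ∀ i, 1 < (p i).toReal := fun i => by
    rw [← ENNReal.toReal_one]
    exact (ENNReal.toReal_lt_toReal ENNReal.one_ne_top (hp i).2.ne).2 (hp i).1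
  set p' : Fin d → ℝ≥0∞ := fun i => ENNReal.ofReal (p i).toReal.conjExponent
  have hpp : ∀ i, (p i).toReal.HolderConjugate (p' i).toReal := fun i => by
    have := Real.HolderConjugate.conjExponent (hp1 i)
    rwa [ENNReal.toReal_ofReal this.symm.nonneg]
  obtain ⟨C, hC⟩ := mixed_doob d p hp1
  obtain ⟨C', hC'⟩ := mixed_doob d p' fun i => (hpp i).symm.lt
  refine ⟨25 * C * C', ?_⟩
  intro Ω mΩ P _ F b hb hb1 f ⟨hf, hfin⟩
  set K : ℝ≥0∞ := (25 * C * C' : ℝ≥0) * seqNorm p P f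
  have hT := martingale_transform hf hb hb1
  have hTm : ∀ n, Measurable (transform b f n) := fun n =>
    ((hT.1 n).measurable).mono ((prodFiltration F).le n) le_rfl
  have hpair : ∀ n (k : (∀ i, Ω i) → ℝ≥0∞), Measurable k →
      ∫⁻ x, ‖transform b f n x‖ₑ * k x ∂Measure.pi P ≤ K * mixedENorm d p' Ω P k := by
    intro n k hk
    refine (lintegral_transform_mul_le hpp (hC Ω P F) (hC' Ω P F) hb hb1 hf n hk).trans ?_
    exact mul_le_mul' (mul_le_mul' le_rfl (le_iSup (fun n => mixedNorm p P (f n)) n)) le_rfl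
  have hseq : seqNorm p P (transform b f) ≤ K :=
    iSup_le fun n => mixedNorm_le_of_forall_pairing hpp F (hTm n) (hpair n)
  have hK : K < ∞ := ENNReal.mul_lt_top ENNReal.coe_lt_top hfin
  refine ⟨⟨hT, hseq.trans_lt hK⟩, hseq, ?_⟩
  have hL1 : ∀ n, eLpNorm (transform b f n) 1 (Measure.pi P) ≤ (K.toNNReal : ℝ≥0∞) := by
    intro n
    have := hpair n (fun _ => 1) measurable_const
    rw [mixedENorm_one fun i => ?_] at this
    · rw [ENNReal.coe_toNNReal hK.ne, eLpNorm_one_eq_lintegral_enorm]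
      simpa using this
    · intro h0
      have := (hpp i).symm.pos
      simp [h0] at this
  obtain ⟨g, hgm, hlim⟩ := measurable_limit_of_tendsto_metrizable_ae
    (fun n => (hTm n).aemeasurable) (hT.submartingale.exists_ae_tendsto_of_bdd hL1)
  -- Fatou is applied to each pairing, so lower semicontinuity of the mixed norm itself is not
  -- needed.
  refine ⟨g, hgm, hlim, mixedNorm_le_of_forall_pairing hpp F hgm fun k hk => ?_⟩
  calc ∫⁻ x, ‖g x‖ₑ * k x ∂Measure.pi P
      ≤ ∫⁻ x, liminf (fun n => ‖transform b f n x‖ₑ * k x) atTop ∂Measure.pi P := by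
        refine lintegral_mono_ae ?_
        filter_upwards [hlim] with x hx
        -- Since `k x` may be `∞`, multiplication by it is continuous only at a nonzero limit.
        by_cases h0 : ‖g x‖ₑ = 0
        · simp [h0]
        · exact (ENNReal.Tendsto.mul_const hx.enorm (Or.inl h0)).liminf_eq.ge
    _ ≤ liminf (fun n => ∫⁻ x, ‖transform b f n x‖ₑ * k x ∂Measure.pi P) atTop :=
        lintegral_liminf_le fun n => (hTm n).enorm.mul hk
    _ ≤ K * mixedENorm d p' Ω P k :=
        liminf_le_of_le (by isBoundedDefault) fun c hc =>
          let ⟨n, hn⟩ := hc.exists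
          hn.trans (hpair n k hk)
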